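/- Let $G\rightrightarrows M$ be a Lie groupoid: $M$ (objects) and $G$ (arrows) are finite-dimensional, Hausdorff, second countable smooth manifolds without boundary, the source and target $s,t:G\to M$ are submersions, and the multiplication (on the submanifold of pairs $(g_2,g_1)$ with $s(g_2)=t(g_1)$), the unit map and the inverse map are smooth and satisfy the usual groupoid axioms. Let $\rho=(t,s):G\to M\times M$ be the anchor. For $x,y\in M$ let $G(y,x)=\{h\in G: t(h)=y,\ s(h)=x\}$, an embedded submanifold of $G$, and let $O=\{t(h): h\in G,\ s(h)=x\}$ be the orbit of $x$, an (initial, possibly not embedded) submanifold of $M$; for $z\in O$ let $N_zO=T_zM/T_zO$. For an arrow $g$ from $x$ to $y$ (that is, $s(g)=x$ and $t(g)=y$), the normal representation $\eta_g:N_xO\to N_yO$ is the linear map defined as follows. Put $G_O=s^{-1}(O)=t^{-1}(O)$ and $N_gG_O=T_gG/T_gG_O$. The differential $d_gs$ induces an isomorphism $\bar s:N_gG_O\to N_xO$, the differential $d_gt$ induces a linear map $\bar t:N_gG_O\to N_yO$, and $\eta_g=\bar t\circ\bar s^{-1}$; equivalently, $\eta_g[d_gs(u)]=[d_gt(u)]$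 for all $u\in T_gG$. Then for every arrow $g$ from $x$ to $y$, the differential $d_g\rho:T_gG\to T_yM\times T_xM$ has kernel and image $$\ker(d_g\rho)=T_gG(y,x),\qquad \operatorname{im}(d_g\rho)=\{(v,w)\in T_yM\times T_xM:\ [v]=\eta_g[w]\ \text{in } N_yO\}.$$ -/

import Mathlib

open Set Manifold
open scoped ContDiff Topology

/-- The tangent space at `p` of a submanifold `S` of a manifold `N`, as a subspace of `T_p N`: it
consists of the velocities at `p` of the smooth curves of `N` that stay in `S`. This is the usual
tangent space whenever `S` is an embedded submanifold, or more generally an initial submanifold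
(a smooth map into `N` with image in `S` is smooth as a map into `S`), such as an orbit of a Lie
groupoid. For such `S` the velocities already form a linear subspace, and the span adds nothing. -/
noncomputable def submanifoldTangentSpace {E : Type*} [NormedAddCommGroup E] [NormedSpace ℝ E]
    {N : Type*} [TopologicalSpace N] [ChartedSpace E N] (S : Set N) (p : N) :
    Submodule ℝ (TangentSpace 𝓘(ℝ, E) p) :=
  Submodule.span ℝ {v | ∃ (γ : ℝ → N) (ε : ℝ), 0 < ε ∧
    ContMDiffOn 𝓘(ℝ, ℝ) 𝓘(ℝ, E) ∞ γ (Ioo (-ε) ε) ∧ (∀ r ∈ Ioo (-ε) ε, γ r ∈ S) ∧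
    tangentMap 𝓘(ℝ, ℝ) 𝓘(ℝ, E) γ ⟨0, (1 : ℝ)⟩ = (⟨p, v⟩ : TangentBundle 𝓘(ℝ, E) N)}

/-- A Lie groupoid `G ⇉ M` with manifold of objects `M` and manifold of arrows `G`.
An arrow `g` goes from `s g` to `t g`, and `mul g₂ g₁` is the composite `g₂ g₁`; it is meaningful
only when `s g₂ = t g₁`, and nothing is required of its values on other pairs. -/
structure LieGroupoid (EM : Type*) [NormedAddCommGroup EM] [NormedSpace ℝ EM]
    (M : Type*) [TopologicalSpace M] [ChartedSpace EM M]
    (EG : Type*) [NormedAddCommGroup EG] [NormedSpace ℝ EG]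
    (G : Type*) [TopologicalSpace G] [ChartedSpace EG G] where
  /-- source -/
  s : G → M
  /-- target -/
  t : G → M
  /-- multiplication of composable arrows -/
  mul : G → G → G
  /-- unit -/
  one : M → G
  /-- inverse -/
  inv : G → G
  isSubmersion_s : IsSubmersion 𝓘(ℝ, EG) 𝓘(ℝ, EM) ∞ s
  isSubmersion_t : IsSubmersion 𝓘(ℝ, EG) 𝓘(ℝ, EM) ∞ t
  /-- `mul` is smooth on the submanifold of composable pairs -/
  contMDiffOn_mul : ContMDiffOn (𝓘(ℝ, EG).prod 𝓘(ℝ, EG)) 𝓘(ℝ, EG) ∞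
    (fun p : G × G ↦ mul p.1 p.2) {p | s p.1 = t p.2}
  contMDiff_one : ContMDiff 𝓘(ℝ, EM) 𝓘(ℝ, EG) ∞ one
  contMDiff_inv : ContMDiff 𝓘(ℝ, EG) 𝓘(ℝ, EG) ∞ inv
  s_mul : ∀ g h, s g = t h → s (mul g h) = s h
  t_mul : ∀ g h, s g = t h → t (mul g h) = t g
  mul_assoc : ∀ g h k, s g = t h → s h = t k → mul (mul g h) k = mul g (mul h k)
  s_one : ∀ x, s (one x) = x
  t_one : ∀ x, t (one x) = x
  mul_one : ∀ g, mul g (one (s g)) = g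
  one_mul : ∀ g, mul (one (t g)) g = g
  s_inv : ∀ g, s (inv g) = t g
  t_inv : ∀ g, t (inv g) = s g
  mul_inv : ∀ g, mul g (inv g) = one (t g)
  inv_mul : ∀ g, mul (inv g) g = one (s g)

/-! ### Helper facts on curves and submersions -/

section Helpers

variable {E : Type*} [NormedAddCommGroup E] [NormedSpace ℝ E]
  {N : Type*} [TopologicalSpace N] [ChartedSpace E N]
  {E' : Type*} [NormedAddCommGroup E'] [NormedSpace ℝ E']
  {N' : Type*} [TopologicalSpace N'] [ChartedSpace E' N']

/-- Two tangent vectors at the same point that agree in the tangent bundle are equal. -/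
theorem tangentVector_ext {p : N} {v w : TangentSpace 𝓘(ℝ, E) p}
    (h : (⟨p, v⟩ : TangentBundle 𝓘(ℝ, E) N) = ⟨p, w⟩) : v = w := by
  cases h; rfl

/-- A smooth map carrying `S` into `S'` carries the tangent space of `S` into that of `S'`. -/
theorem mfderiv_mem_submanifoldTangentSpace {f : N → N'}
    (hf : ContMDiff 𝓘(ℝ, E) 𝓘(ℝ, E') ∞ f) {S : Set N} {S' : Set N'} (hS : ∀ q ∈ S, f q ∈ S')
    (p : N) : submanifoldTangentSpace (E := E) S p ≤
      (submanifoldTangentSpace (E := E') S' (f p)).comap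
        (mfderiv 𝓘(ℝ, E) 𝓘(ℝ, E') f p).toLinearMap := by
  refine Submodule.span_le.2 ?_
  rintro v ⟨γ, ε, hε, hγ, hγS, hv⟩
  refine Submodule.subset_span ⟨f ∘ γ, ε, hε, hf.comp_contMDiffOn hγ,
    fun r hr ↦ hS _ (hγS r hr), ?_⟩
  have h0 : MDifferentiableAt 𝓘(ℝ, ℝ) 𝓘(ℝ, E) γ 0 :=
    (hγ.contMDiffAt (Ioo_mem_nhds (by linarith) hε)).mdifferentiableAt (by simp)
  have h1 : MDifferentiableAt 𝓘(ℝ, E) 𝓘(ℝ, E') f (γ 0) := hf.mdifferentiable (by simp) _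
  rw [tangentMap_comp_at (I' := 𝓘(ℝ, E)) (p := ⟨0, (1 : ℝ)⟩) h1 h0, hv]
  rfl

/-- A submersion has a smooth local section through every point. -/
theorem exists_localSection [IsManifold 𝓘(ℝ, E) ∞ N] [IsManifold 𝓘(ℝ, E') ∞ N'] {f : N → N'}
    (hf : IsSubmersion 𝓘(ℝ, E) 𝓘(ℝ, E') ∞ f) (p : N) :
    ∃ (U : Set N') (σ : N' → N), IsOpen U ∧ f p ∈ U ∧
      ContMDiffOn 𝓘(ℝ, E') 𝓘(ℝ, E) ∞ σ U ∧ σ (f p) = p ∧ ∀ z ∈ U, f (σ z) = z := by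
  obtain ⟨F, _, _, hF⟩ := hf
  obtain ⟨φ, ψ, hp, hfp, hφ, hψ, hsub, e, he⟩ := hF p
  have he' : ∀ y ∈ φ.target, ψ (f (φ.symm y)) = (e y).1 := by
    intro y hy
    have := he (x := y) (by simpa using hy)
    simpa using this
  let q : N' → E := fun z ↦ e.symm (ψ z, (e (φ p)).2)
  have hψf : ψ (f p) = (e (φ p)).1 := by
    have := he' (φ p) (φ.map_source hp)
    rwa [φ.left_inv hp] at this
  have hq0 : q (f p) = φ p := by simp [q, hψf]
  have hqs : ContMDiffOn 𝓘(ℝ, E') 𝓘(ℝ, E) ∞ q ψ.source := by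
    have h1 := contMDiffOn_of_mem_maximalAtlas (I := 𝓘(ℝ, E')) (n := ∞) hψ
    have h2 : ContDiff ℝ ∞ (fun y : E' ↦ e.symm (y, (e (φ p)).2)) := by fun_prop
    exact h2.contMDiff.comp_contMDiffOn h1
  have hopen : IsOpen (ψ.source ∩ q ⁻¹' φ.target) :=
    hqs.continuousOn.isOpen_inter_preimage ψ.open_source φ.open_target
  refine ⟨ψ.source ∩ q ⁻¹' φ.target, fun z ↦ φ.symm (q z), hopen,
    ⟨hfp, by simpa [hq0] using φ.map_source hp⟩, ?_, ?_, ?_⟩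
  · exact (contMDiffOn_symm_of_mem_maximalAtlas (I := 𝓘(ℝ, E)) (n := ∞) hφ).comp
      (hqs.mono inter_subset_left) (fun z hz ↦ hz.2)
  · simp [hq0, φ.left_inv hp]
  · rintro z ⟨hz, hz'⟩
    refine ψ.injOn (hsub (φ.map_target hz')) hz ?_
    rw [he' _ hz']
    simp [q]

/-- The differential of a submersion is surjective. -/
theorem mfderiv_surjective_of_isSubmersion [IsManifold 𝓘(ℝ, E) ∞ N] [IsManifold 𝓘(ℝ, E') ∞ N']
    {f : N → N'} (hf : IsSubmersion 𝓘(ℝ, E) 𝓘(ℝ, E') ∞ f) (p : N) :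
    Function.Surjective (mfderiv 𝓘(ℝ, E) 𝓘(ℝ, E') f p) := by
  obtain ⟨U, σ, hU, hpU, hσ, hσp, hfσ⟩ := exists_localSection hf p
  intro w
  have hs : MDifferentiableAt 𝓘(ℝ, E') 𝓘(ℝ, E) σ (f p) :=
    (hσ.contMDiffAt (hU.mem_nhds hpU)).mdifferentiableAt (by simp)
  have hfd : MDifferentiableAt 𝓘(ℝ, E) 𝓘(ℝ, E') f (σ (f p)) :=
    hf.contMDiff.mdifferentiable (by simp) _
  have h1 : HasMFDerivAt 𝓘(ℝ, E') 𝓘(ℝ, E') (f ∘ σ) (f p) _ :=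
    hfd.hasMFDerivAt.comp (f p) hs.hasMFDerivAt
  have h2 : HasMFDerivAt 𝓘(ℝ, E') 𝓘(ℝ, E') (f ∘ σ) (f p) (ContinuousLinearMap.id ℝ _) :=
    (hasMFDerivAt_id (f p)).congr_of_eventuallyEq
      (Filter.eventually_of_mem (hU.mem_nhds hpU) fun z hz ↦ hfσ z hz)
  have h3 := hasMFDerivAt_unique h1 h2
  rw [hσp] at h3
  exact ⟨_, DFunLike.congr_fun h3 w⟩

/-- Vectors killed by the differential of a submersion `f` are velocities of curves along which `f`
is constant. -/
theorem ker_le_submanifoldTangentSpace_preimage [IsManifold 𝓘(ℝ, E) ∞ N]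
    [IsManifold 𝓘(ℝ, E') ∞ N'] {f : N → N'}
    (hf : IsSubmersion 𝓘(ℝ, E) 𝓘(ℝ, E') ∞ f) {S : Set N'} {p : N} (hp : f p ∈ S)
    {u : TangentSpace 𝓘(ℝ, E) p} (hu : mfderiv 𝓘(ℝ, E) 𝓘(ℝ, E') f p u = 0) :
    u ∈ submanifoldTangentSpace (E := E) (f ⁻¹' S) p := by
  have hfs := hf.contMDiff
  obtain ⟨F, _, _, hF⟩ := hf
  obtain ⟨φ, ψ, hpφ, hfp, hφ, hψ, hsub, e, he⟩ := hF p
  have he' : ∀ y ∈ φ.target, ψ (f (φ.symm y)) = (e y).1 := by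
    intro y hy
    have := he (x := y) (by simpa using hy)
    simpa using this
  have dφ : MDifferentiableAt 𝓘(ℝ, E) 𝓘(ℝ, E) φ p :=
    ((contMDiffOn_of_mem_maximalAtlas (I := 𝓘(ℝ, E)) (n := ∞) hφ).contMDiffAt
      (φ.open_source.mem_nhds hpφ)).mdifferentiableAt (by simp)
  have sφ := contMDiffOn_symm_of_mem_maximalAtlas (I := 𝓘(ℝ, E)) (n := ∞) hφ
  have dφs : MDifferentiableAt 𝓘(ℝ, E) 𝓘(ℝ, E) φ.symm (φ p) :=
    (sφ.contMDiffAt (φ.open_target.mem_nhds (φ.map_source hpφ))).mdifferentiableAt (by simp)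
  have dψ : MDifferentiableAt 𝓘(ℝ, E') 𝓘(ℝ, E') ψ (f p) :=
    ((contMDiffOn_of_mem_maximalAtlas (I := 𝓘(ℝ, E')) (n := ∞) hψ).contMDiffAt
      (ψ.open_source.mem_nhds hfp)).mdifferentiableAt (by simp)
  have df : MDifferentiableAt 𝓘(ℝ, E) 𝓘(ℝ, E') f p := hfs.mdifferentiable (by simp) _
  let a : E := mfderiv 𝓘(ℝ, E) 𝓘(ℝ, E) φ p u
  -- in the charts the first component of `a` vanishes
  have hea : (e a).1 = 0 := by
    have h1 : HasMFDerivAt 𝓘(ℝ, E) 𝓘(ℝ, E') (ψ ∘ f) p _ :=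
      dψ.hasMFDerivAt.comp p df.hasMFDerivAt
    have hL : HasMFDerivAt 𝓘(ℝ, E) 𝓘(ℝ, E') (fun y : E ↦ (e y).1) (φ p)
        ((ContinuousLinearMap.fst ℝ E' F).comp (e : E →L[ℝ] E' × F)) :=
      ((ContinuousLinearMap.fst ℝ E' F).comp (e : E →L[ℝ] E' × F)).hasFDerivAt.hasMFDerivAt
    have h2 : HasMFDerivAt 𝓘(ℝ, E) 𝓘(ℝ, E') ((fun y : E ↦ (e y).1) ∘ φ) p _ :=
      hL.comp p dφ.hasMFDerivAt
    have h3 : ψ ∘ f =ᶠ[𝓝 p] (fun y : E ↦ (e y).1) ∘ φ := by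
      filter_upwards [φ.open_source.mem_nhds hpφ] with z hz
      have := he' (φ z) (φ.map_source hz)
      rw [φ.left_inv hz] at this
      exact this
    have h4 := DFunLike.congr_fun (hasMFDerivAt_unique (h2.congr_of_eventuallyEq h3) h1) u
    have h5 : (e a).1 = mfderiv 𝓘(ℝ, E') 𝓘(ℝ, E') ψ (f p) (mfderiv 𝓘(ℝ, E) 𝓘(ℝ, E') f p u) := h4
    rw [h5, hu]
    exact map_zero _
  let c : ℝ → E := fun r ↦ φ p + r • a
  have hc : ContDiff ℝ ∞ c := by fun_prop
  obtain ⟨ε, hε, hball⟩ : ∃ ε > 0, Ioo (-ε) ε ⊆ c ⁻¹' φ.target := by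
    have : c ⁻¹' φ.target ∈ 𝓝 (0 : ℝ) :=
      hc.continuous.continuousAt.preimage_mem_nhds
        (φ.open_target.mem_nhds (by simpa [c] using φ.map_source hpφ))
    obtain ⟨ε, hε, h⟩ := Metric.mem_nhds_iff.1 this
    refine ⟨ε, hε, ?_⟩
    rwa [Real.ball_eq_Ioo, zero_sub, zero_add] at h
  have hc0 : c 0 = φ p := by simp [c]
  refine Submodule.subset_span ⟨φ.symm ∘ c, ε, hε, sφ.comp hc.contMDiff.contMDiffOn hball, ?_, ?_⟩
  · intro r hr
    have hr' : c r ∈ φ.target := hball hr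
    have : f (φ.symm (c r)) = f p := by
      refine ψ.injOn (hsub (φ.map_target hr')) hfp ?_
      have h0 := he' (φ p) (φ.map_source hpφ)
      rw [φ.left_inv hpφ] at h0
      rw [he' _ hr', h0]
      simp [c, hea]
    change f (φ.symm (c r)) ∈ S
    rwa [this]
  · have hcd : HasMFDerivAt 𝓘(ℝ, ℝ) 𝓘(ℝ, E) c 0 ((1 : ℝ →L[ℝ] ℝ).smulRight a) := by
      have h : HasDerivAt c a 0 := by
        simpa [c] using ((hasDerivAt_id (0 : ℝ)).smul_const a).const_add (φ p)
      exact h.hasFDerivAt.hasMFDerivAt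
    have dφs' : MDifferentiableAt 𝓘(ℝ, E) 𝓘(ℝ, E) φ.symm (c 0) := by rwa [hc0]
    rw [tangentMap_comp_at (I' := 𝓘(ℝ, E)) (p := ⟨0, (1 : ℝ)⟩) dφs' hcd.mdifferentiableAt]
    have h1 : tangentMap 𝓘(ℝ, ℝ) 𝓘(ℝ, E) c ⟨0, (1 : ℝ)⟩ =
        tangentMap 𝓘(ℝ, E) 𝓘(ℝ, E) φ ⟨p, u⟩ := by
      have : mfderiv 𝓘(ℝ, ℝ) 𝓘(ℝ, E) c 0 (1 : ℝ) = a := by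
        rw [hcd.mfderiv]
        exact one_smul ℝ a
      unfold tangentMap
      dsimp only
      rw [this, hc0]
    rw [h1, ← tangentMap_comp_at (I' := 𝓘(ℝ, E)) (p := ⟨p, u⟩) dφs dφ]
    have h2 : HasMFDerivAt 𝓘(ℝ, E) 𝓘(ℝ, E) (φ.symm ∘ φ) p (ContinuousLinearMap.id ℝ _) :=
      (hasMFDerivAt_id p).congr_of_eventuallyEq
        (Filter.eventually_of_mem (φ.open_source.mem_nhds hpφ) fun z hz ↦ φ.left_inv hz)
    unfold tangentMap
    dsimp only
    rw [h2.mfderiv]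
    simp only [Function.comp_apply]
    rw [φ.left_inv hpφ]
    rfl

/-- The preimage of `S` under a submersion `f` has all of `(df)⁻¹(TS)` in its tangent space. -/
theorem comap_le_submanifoldTangentSpace_preimage [IsManifold 𝓘(ℝ, E) ∞ N]
    [IsManifold 𝓘(ℝ, E') ∞ N'] {f : N → N'}
    (hf : IsSubmersion 𝓘(ℝ, E) 𝓘(ℝ, E') ∞ f) {S : Set N'} {p : N} (hp : f p ∈ S) :
    (submanifoldTangentSpace (E := E') S (f p)).comap
        (mfderiv 𝓘(ℝ, E) 𝓘(ℝ, E') f p).toLinearMap ≤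
      submanifoldTangentSpace (E := E) (f ⁻¹' S) p := by
  obtain ⟨U, σ, hU, hpU, hσ, hσp, hfσ⟩ := exists_localSection hf p
  -- velocities of curves in `S` lift to velocities of curves in the preimage
  have hlift : submanifoldTangentSpace (E := E') S (f p) ≤
      (submanifoldTangentSpace (E := E) (f ⁻¹' S) p).map
        (mfderiv 𝓘(ℝ, E) 𝓘(ℝ, E') f p).toLinearMap := by
    refine Submodule.span_le.2 ?_
    rintro w ⟨γ, ε, hε, hγ, hγS, hw⟩
    have hγ0 : γ 0 = f p := congrArg Bundle.TotalSpace.proj hw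
    have hγc : ContMDiffAt 𝓘(ℝ, ℝ) 𝓘(ℝ, E') ∞ γ 0 :=
      hγ.contMDiffAt (Ioo_mem_nhds (by linarith) hε)
    have hγd : MDifferentiableAt 𝓘(ℝ, ℝ) 𝓘(ℝ, E') γ 0 := hγc.mdifferentiableAt (by simp)
    obtain ⟨δ, hδ, hball⟩ : ∃ δ > 0, Ioo (-δ) δ ⊆ Ioo (-ε) ε ∩ γ ⁻¹' U := by
      have : Ioo (-ε) ε ∩ γ ⁻¹' U ∈ 𝓝 (0 : ℝ) :=
        Filter.inter_mem (Ioo_mem_nhds (by linarith) hε)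
          (hγc.continuousAt.preimage_mem_nhds (hU.mem_nhds (by rwa [hγ0])))
      obtain ⟨δ, hδ, h⟩ := Metric.mem_nhds_iff.1 this
      refine ⟨δ, hδ, ?_⟩
      rwa [Real.ball_eq_Ioo, zero_sub, zero_add] at h
    have hσγ : ContMDiffOn 𝓘(ℝ, ℝ) 𝓘(ℝ, E) ∞ (σ ∘ γ) (Ioo (-δ) δ) :=
      hσ.comp (hγ.mono fun r hr ↦ (hball hr).1) (fun r hr ↦ (hball hr).2)
    have hσγd : MDifferentiableAt 𝓘(ℝ, ℝ) 𝓘(ℝ, E) (σ ∘ γ) 0 :=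
      (hσγ.contMDiffAt (Ioo_mem_nhds (by linarith) hδ)).mdifferentiableAt (by simp)
    have h0 : (σ ∘ γ) 0 = p := by simp [hγ0, hσp]
    obtain ⟨u, hu⟩ : ∃ u : TangentSpace 𝓘(ℝ, E) p,
        tangentMap 𝓘(ℝ, ℝ) 𝓘(ℝ, E) (σ ∘ γ) ⟨0, (1 : ℝ)⟩ = ⟨p, u⟩ := by
      unfold tangentMap
      dsimp only
      rw [h0]
      exact ⟨_, rfl⟩
    refine ⟨u, Submodule.subset_span ⟨σ ∘ γ, δ, hδ, hσγ, ?_, hu⟩, ?_⟩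
    · intro r hr
      change f (σ (γ r)) ∈ S
      rw [hfσ _ (hball hr).2]
      exact hγS r (hball hr).1
    · refine tangentVector_ext (N := N') ?_
      have hfd : MDifferentiableAt 𝓘(ℝ, E) 𝓘(ℝ, E') f ((σ ∘ γ) 0) :=
        hf.contMDiff.mdifferentiable (by simp) _
      have h1 := tangentMap_comp_at (I' := 𝓘(ℝ, E)) (p := ⟨0, (1 : ℝ)⟩) hfd hσγd
      rw [hu] at h1
      have h2 : f ∘ (σ ∘ γ) =ᶠ[𝓝 0] γ :=
        Filter.eventually_of_mem (Ioo_mem_nhds (by linarith) hδ) fun r hr ↦ hfσ _ (hball hr).2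
      have h3 : tangentMap 𝓘(ℝ, ℝ) 𝓘(ℝ, E') (f ∘ (σ ∘ γ)) ⟨0, (1 : ℝ)⟩ =
          tangentMap 𝓘(ℝ, ℝ) 𝓘(ℝ, E') γ ⟨0, (1 : ℝ)⟩ := by
        unfold tangentMap
        dsimp only
        rw [h2.mfderiv_eq, h2.eq_of_nhds]
      rw [← hw, ← h3, h1]
      rfl
  intro u hu
  obtain ⟨u', hu', huu'⟩ := hlift hu
  have hk := ker_le_submanifoldTangentSpace_preimage hf (S := S) hp (u := u - u') (by
    have : mfderiv 𝓘(ℝ, E) 𝓘(ℝ, E') f p u' = mfderiv 𝓘(ℝ, E) 𝓘(ℝ, E') f p u := huu'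
    rw [map_sub, this, sub_self])
  simpa using Submodule.add_mem _ hk hu'

end Helpers

namespace LieGroupoid

variable {EM : Type*} [NormedAddCommGroup EM] [NormedSpace ℝ EM]
  {M : Type*} [TopologicalSpace M] [ChartedSpace EM M]
  {EG : Type*} [NormedAddCommGroup EG] [NormedSpace ℝ EG]
  {G : Type*} [TopologicalSpace G] [ChartedSpace EG G]

/-- The set `G(y, x)` of arrows from `x` to `y`. -/
def arrows (𝒢 : LieGroupoid EM M EG G) (y x : M) : Set G := {g | 𝒢.t g = y ∧ 𝒢.s g = x}

/-- The orbit `O_x` of `x`. -/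
def orbit (𝒢 : LieGroupoid EM M EG G) (x : M) : Set M := {y | ∃ g, 𝒢.s g = x ∧ 𝒢.t g = y}

/-- The anchor `ρ = (t, s) : G → M × M`. -/
def anchor (𝒢 : LieGroupoid EM M EG G) (g : G) : M × M := (𝒢.t g, 𝒢.s g)

/-- The tangent space `T_x O` at `x` of the orbit `O` of `x`. -/
noncomputable def orbitTangentSpace (𝒢 : LieGroupoid EM M EG G) (x : M) :
    Submodule ℝ (TangentSpace 𝓘(ℝ, EM) x) :=
  submanifoldTangentSpace (𝒢.orbit x) x

/-- The normal space `N_x O = T_x M / T_x O` at `x` to the orbit `O` of `x`. -/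
abbrev NormalSpace (𝒢 : LieGroupoid EM M EG G) (x : M) : Type _ :=
  TangentSpace 𝓘(ℝ, EM) x ⧸ 𝒢.orbitTangentSpace x

/-- The tangent space `T_g G_O` at `g` of the restriction `G_O = s⁻¹(O) = t⁻¹(O)` of the groupoid
to the orbit `O` of `s g`. -/
noncomputable def restrictionTangentSpace (𝒢 : LieGroupoid EM M EG G) (g : G) :
    Submodule ℝ (TangentSpace 𝓘(ℝ, EG) g) :=
  submanifoldTangentSpace (𝒢.s ⁻¹' 𝒢.orbit (𝒢.s g)) g

/-- The normal space `N_g G_O = T_g G / T_g G_O`. -/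
abbrev RestrictionNormalSpace (𝒢 : LieGroupoid EM M EG G) (g : G) : Type _ :=
  TangentSpace 𝓘(ℝ, EG) g ⧸ 𝒢.restrictionTangentSpace g

theorem mem_orbit_self (𝒢 : LieGroupoid EM M EG G) (x : M) : x ∈ 𝒢.orbit x :=
  ⟨𝒢.one x, 𝒢.s_one x, 𝒢.t_one x⟩

theorem t_mem_orbit (𝒢 : LieGroupoid EM M EG G) (g h : G)
    (hh : 𝒢.s h ∈ 𝒢.orbit (𝒢.s g)) : 𝒢.t h ∈ 𝒢.orbit (𝒢.t g) := by
  obtain ⟨k, hk, hk'⟩ := hh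
  have h1 : 𝒢.s k = 𝒢.t (𝒢.inv g) := by rw [hk, 𝒢.t_inv]
  have h2 : 𝒢.s h = 𝒢.t (𝒢.mul k (𝒢.inv g)) := by rw [𝒢.t_mul _ _ h1, hk']
  exact ⟨𝒢.mul h (𝒢.mul k (𝒢.inv g)), by rw [𝒢.s_mul _ _ h2, 𝒢.s_mul _ _ h1, 𝒢.s_inv],
    𝒢.t_mul _ _ h2⟩

/-- The linear map `N_g G_O → N_x O`, `x = s g`, induced by the differential of the source. -/
noncomputable def sourceNormal (𝒢 : LieGroupoid EM M EG G) (g : G) :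
    𝒢.RestrictionNormalSpace g →ₗ[ℝ] 𝒢.NormalSpace (𝒢.s g) :=
  Submodule.mapQ _ _ (mfderiv 𝓘(ℝ, EG) 𝓘(ℝ, EM) 𝒢.s g).toLinearMap
    (mfderiv_mem_submanifoldTangentSpace 𝒢.isSubmersion_s.contMDiff (fun _ h ↦ h) g)

/-- The linear map `N_g G_O → N_y O`, `y = t g`, induced by the differential of the target. -/
noncomputable def targetNormal (𝒢 : LieGroupoid EM M EG G) (g : G) :
    𝒢.RestrictionNormalSpace g →ₗ[ℝ] 𝒢.NormalSpace (𝒢.t g) :=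
  Submodule.mapQ _ _ (mfderiv 𝓘(ℝ, EG) 𝓘(ℝ, EM) 𝒢.t g).toLinearMap
    (mfderiv_mem_submanifoldTangentSpace 𝒢.isSubmersion_t.contMDiff
      (fun h hh ↦ 𝒢.t_mem_orbit g h hh) g)

theorem sourceNormal_bijective [IsManifold 𝓘(ℝ, EM) ∞ M] [IsManifold 𝓘(ℝ, EG) ∞ G]
    (𝒢 : LieGroupoid EM M EG G) (g : G) : Function.Bijective (𝒢.sourceNormal g) := by
  constructor
  · rw [← LinearMap.ker_eq_bot, eq_bot_iff]
    intro a ha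
    obtain ⟨u, rfl⟩ := Submodule.mkQ_surjective _ a
    have hu : mfderiv 𝓘(ℝ, EG) 𝓘(ℝ, EM) 𝒢.s g u ∈ 𝒢.orbitTangentSpace (𝒢.s g) :=
      (Submodule.Quotient.mk_eq_zero _).1 ha
    exact (Submodule.Quotient.mk_eq_zero _).2
      (comap_le_submanifoldTangentSpace_preimage 𝒢.isSubmersion_s (𝒢.mem_orbit_self _) hu)
  · intro b
    obtain ⟨w, rfl⟩ := Submodule.mkQ_surjective _ b
    obtain ⟨u, rfl⟩ := mfderiv_surjective_of_isSubmersion 𝒢.isSubmersion_s g w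
    exact ⟨Submodule.Quotient.mk u, rfl⟩

/-- The normal representation `η_g : N_x O → N_y O` of an arrow `g` from `x` to `y`: the inverse of
the isomorphism `N_g G_O ≅ N_x O` induced by the source, followed by the map `N_g G_O → N_y O`
induced by the target. -/
noncomputable def normalRep [IsManifold 𝓘(ℝ, EM) ∞ M] [IsManifold 𝓘(ℝ, EG) ∞ G]
    (𝒢 : LieGroupoid EM M EG G) (g : G) : 𝒢.NormalSpace (𝒢.s g) →ₗ[ℝ] 𝒢.NormalSpace (𝒢.t g) :=
  𝒢.targetNormal g ∘ₗ
    (LinearEquiv.ofBijective (𝒢.sourceNormal g) (𝒢.sourceNormal_bijective g)).symm.toLinearMap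

/-- `η_g` sends the class of `d_g s (u)` to the class of `d_g t (u)`, for all `u ∈ T_g G`. -/
theorem normalRep_mk [IsManifold 𝓘(ℝ, EM) ∞ M] [IsManifold 𝓘(ℝ, EG) ∞ G]
    (𝒢 : LieGroupoid EM M EG G) (g : G) (u : TangentSpace 𝓘(ℝ, EG) g) :
    𝒢.normalRep g (Submodule.Quotient.mk (mfderiv 𝓘(ℝ, EG) 𝓘(ℝ, EM) 𝒢.s g u)) =
      Submodule.Quotient.mk (mfderiv 𝓘(ℝ, EG) 𝓘(ℝ, EM) 𝒢.t g u) := by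
  have h : (LinearEquiv.ofBijective (𝒢.sourceNormal g) (𝒢.sourceNormal_bijective g)).symm
      (Submodule.Quotient.mk (mfderiv 𝓘(ℝ, EG) 𝓘(ℝ, EM) 𝒢.s g u)) = Submodule.Quotient.mk u :=
    (LinearEquiv.symm_apply_eq _).2 rfl
  exact congrArg (𝒢.targetNormal g) h

end LieGroupoid

/-!
For an arrow `g` let `D g` be the image of `ker d_g s` under `d_g t`. Right translations show that
`D g` depends only on `t g`, and inversion together with rank–nullity shows that `dim D` is also
the same at `s g` and at `t g`. Hence `t` has constant rank along every source fibre. The constant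
rank theorem turns `ker d_g s ∩ ker d_g t` into tangent vectors of `G(y,x)`, and the image of
`d_g ρ` is as claimed once `T_y O = D g`.

The inclusion `T_y O ⊆ D g` is the delicate one, because a smooth curve `γ` in the orbit of `x` is
only known to lift to `s⁻¹(x)` as a family of arrows `h r` without any continuity. As `G` is second
countable, for all but countably many `r` the point `(r, h r)` is an accumulation point of the graph
of `h`. Near such an arrow the constant rank theorem gives a smooth map `τ` into the source fibre
such that `t ∘ τ` fixes the targets of nearby arrows of that fibre. So `γ` agrees with `t ∘ τ ∘ γ`
along a sequence of times tending to `r`, and `γ' r` lies in `D (h r)`. Since `dim D` is constant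
along the orbit, this extends from a dense set of times to all times.
-/

open Filter
open Module (finrank)

section ModelDerivative

variable (E : Type*) [NormedAddCommGroup E] [NormedSpace ℝ E]
  {N : Type*} [TopologicalSpace N] [ChartedSpace E N]
  (E' : Type*) [NormedAddCommGroup E'] [NormedSpace ℝ E']
  {N' : Type*} [TopologicalSpace N'] [ChartedSpace E' N']
  (E'' : Type*) [NormedAddCommGroup E''] [NormedSpace ℝ E'']
  {N'' : Type*} [TopologicalSpace N''] [ChartedSpace E'' N'']

/-- The differential of `f` at `z` as a map between the model spaces, so that differentials at
different points can be compared and composed without transport. -/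
noncomputable def modelDeriv (f : N → N') (z : N) : E →L[ℝ] E' :=
  mfderiv 𝓘(ℝ, E) 𝓘(ℝ, E') f z

/-- The rank of the differential of `f` at `z`. -/
noncomputable def mrank (f : N → N') (z : N) : ℕ :=
  finrank ℝ (modelDeriv E E' f z).range

/-- The image under `d_z k` of the tangent space `ker d_z f` of the fibre of `f` through `z`. -/
noncomputable def fiberRange (f : N → N') (k : N → N'') (z : N) : Submodule ℝ E'' :=
  (modelDeriv E E' f z).ker.map (modelDeriv E E'' k z).toLinearMap

/-- `f` is smooth on a neighbourhood of `z`. This is stronger than `ContMDiffAt` of order `∞`, where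
the neighbourhood may shrink with the order of differentiation. -/
def SmoothNear (f : N → N') (z : N) : Prop :=
  ∀ᶠ z' in 𝓝 z, ContMDiffAt 𝓘(ℝ, E) 𝓘(ℝ, E') ∞ f z'

variable {E E' E''}

theorem SmoothNear.contMDiffAt {f : N → N'} {z : N} (hf : SmoothNear E E' f z) :
    ContMDiffAt 𝓘(ℝ, E) 𝓘(ℝ, E') ∞ f z :=
  hf.self_of_nhds

theorem SmoothNear.continuousAt {f : N → N'} {z : N} (hf : SmoothNear E E' f z) :
    ContinuousAt f z :=
  hf.contMDiffAt.continuousAt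

theorem SmoothNear.mdifferentiableAt {f : N → N'} {z : N} (hf : SmoothNear E E' f z) :
    MDifferentiableAt 𝓘(ℝ, E) 𝓘(ℝ, E') f z :=
  hf.contMDiffAt.mdifferentiableAt (by simp)

theorem SmoothNear.comp {k : N' → N''} {f : N → N'} {z : N} (hk : SmoothNear E' E'' k (f z))
    (hf : SmoothNear E E' f z) : SmoothNear E E'' (k ∘ f) z := by
  filter_upwards [hf, hf.continuousAt.eventually hk] with z' hfz hkz using hkz.comp z' hfz

theorem smoothNear_of_contMDiff {f : N → N'} (hf : ContMDiff 𝓘(ℝ, E) 𝓘(ℝ, E') ∞ f) (z : N) :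
    SmoothNear E E' f z :=
  .of_forall hf

theorem smoothNear_of_contDiff {f : E → E'} (hf : ContDiff ℝ ∞ f) (z : E) :
    SmoothNear E E' f z :=
  smoothNear_of_contMDiff hf.contMDiff z

theorem hasMFDerivAt_modelDeriv {f : N → N'} {z : N}
    (hf : MDifferentiableAt 𝓘(ℝ, E) 𝓘(ℝ, E') f z) :
    HasMFDerivAt 𝓘(ℝ, E) 𝓘(ℝ, E') f z (modelDeriv E E' f z) :=
  hf.hasMFDerivAt

theorem modelDeriv_comp {f : N → N'} {k : N' → N''} (z : N)
    (hk : MDifferentiableAt 𝓘(ℝ, E') 𝓘(ℝ, E'') k (f z))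
    (hf : MDifferentiableAt 𝓘(ℝ, E) 𝓘(ℝ, E') f z) :
    modelDeriv E E'' (k ∘ f) z = (modelDeriv E' E'' k (f z)).comp (modelDeriv E E' f z) :=
  mfderiv_comp z hk hf

theorem modelDeriv_congr {f f' : N → N'} {z : N} (h : f =ᶠ[𝓝 z] f') :
    modelDeriv E E' f z = modelDeriv E E' f' z :=
  h.mfderiv_eq

theorem modelDeriv_eq_zero_of_eventually_eq {f : N → N'} {z : N} {c : N'}
    (h : ∀ᶠ z' in 𝓝 z, f z' = c) : modelDeriv E E' f z = 0 :=
  (modelDeriv_congr h).trans mfderiv_const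

theorem modelDeriv_eq_fderiv (f : E → E') (z : E) : modelDeriv E E' f z = fderiv ℝ f z :=
  mfderiv_eq_fderiv

theorem modelDeriv_id (z : N) : modelDeriv E E (id : N → N) z = ContinuousLinearMap.id ℝ E :=
  mfderiv_id

theorem mrank_comp_le_left [FiniteDimensional ℝ E'] {f : N → N'} {k : N' → N''} (z : N)
    (hk : MDifferentiableAt 𝓘(ℝ, E') 𝓘(ℝ, E'') k (f z))
    (hf : MDifferentiableAt 𝓘(ℝ, E) 𝓘(ℝ, E') f z) :
    mrank E E'' (k ∘ f) z ≤ mrank E' E'' k (f z) := by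
  rw [mrank, modelDeriv_comp z hk hf]
  exact Submodule.finrank_mono (LinearMap.range_comp_le_range _ _)

theorem mrank_comp_le_right [FiniteDimensional ℝ E] {f : N → N'} {k : N' → N''} (z : N)
    (hk : MDifferentiableAt 𝓘(ℝ, E') 𝓘(ℝ, E'') k (f z))
    (hf : MDifferentiableAt 𝓘(ℝ, E) 𝓘(ℝ, E') f z) :
    mrank E E'' (k ∘ f) z ≤ mrank E E' f z := by
  have hrange : (modelDeriv E E'' (k ∘ f) z).range =
      (modelDeriv E E' f z).range.map (modelDeriv E' E'' k (f z)).toLinearMap := by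
    rw [modelDeriv_comp z hk hf]
    exact LinearMap.range_comp _ _
  rw [mrank, hrange]
  exact Submodule.finrank_map_le _ _

end ModelDerivative

section ConstantRank

theorem apply_inr_eq_zero_of_finrank_range_le {R K E : Type*} [AddCommGroup R] [Module ℝ R]
    [FiniteDimensional ℝ R] [AddCommGroup K] [Module ℝ K] [FiniteDimensional ℝ K]
    [AddCommGroup E] [Module ℝ E] {L : R × K →ₗ[ℝ] E} {P : E →ₗ[ℝ] R}
    (hPL : ∀ z, P (L z) = z.1) (hrank : finrank ℝ L.range ≤ finrank ℝ R) (κ : K) :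
    L (0, κ) = 0 := by
  have hsurj : Function.Surjective (P.domRestrict L.range) := fun a ↦ ⟨⟨L (a, 0), _, rfl⟩, hPL _⟩
  have hinj : Function.Injective (P.domRestrict L.range) :=
    (LinearMap.injective_iff_surjective_of_finrank_eq_finrank
      (hrank.antisymm (LinearMap.finrank_le_finrank_of_surjective hsurj))).2 hsurj
  have hzero : (⟨L (0, κ), _, rfl⟩ : L.range) = 0 :=
    hinj ((hPL (0, κ)).trans (map_zero (P.domRestrict L.range)).symm)
  exact congrArg Subtype.val hzero

theorem eventually_eq_apply_fst_of_finrank_range_fderiv_le {R K E : Type*}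
    [NormedAddCommGroup R] [NormedSpace ℝ R] [FiniteDimensional ℝ R]
    [NormedAddCommGroup K] [NormedSpace ℝ K] [FiniteDimensional ℝ K]
    [NormedAddCommGroup E] [NormedSpace ℝ E] {f : R × K → E} {P : E →L[ℝ] R} {z₀ : R × K}
    (hf : ∀ᶠ z in 𝓝 z₀, DifferentiableAt ℝ f z) (hPf : ∀ᶠ z in 𝓝 z₀, P (f z) = z.1)
    (hrank : ∀ᶠ z in 𝓝 z₀, finrank ℝ (fderiv ℝ f z).range ≤ finrank ℝ R) :
    ∀ᶠ z in 𝓝 z₀, f z = f (z.1, z₀.2) := by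
  obtain ⟨a₀, k₀⟩ := z₀
  obtain ⟨δ, hδ, hball⟩ :=
    Metric.eventually_nhds_iff_ball.1 (hf.and (hPf.eventually_nhds.and hrank))
  rw [← ball_prod_same] at hball
  have hderiv : ∀ a ∈ Metric.ball a₀ δ, ∀ k ∈ Metric.ball k₀ δ,
      HasFDerivAt (fun k ↦ f (a, k)) (0 : K →L[ℝ] E) k := by
    intro a ha k hk
    obtain ⟨hfz, hPfz, hrankz⟩ := hball (a, k) ⟨ha, hk⟩
    have hPL : P.comp (fderiv ℝ f (a, k)) = ContinuousLinearMap.fst ℝ R K :=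
      (P.hasFDerivAt.comp (a, k) hfz.hasFDerivAt).unique
        (hasFDerivAt_fst.congr_of_eventuallyEq hPfz)
    refine (hfz.hasFDerivAt.comp k (hasFDerivAt_prodMk_right a k)).congr_fderiv ?_
    ext κ
    exact apply_inr_eq_zero_of_finrank_range_le (L := (fderiv ℝ f (a, k)).toLinearMap)
      (P := P.toLinearMap) (DFunLike.congr_fun hPL) hrankz κ
  filter_upwards [Metric.ball_mem_nhds (a₀, k₀) hδ] with z hz
  rw [← ball_prod_same] at hz
  exact Metric.isOpen_ball.is_const_of_fderiv_eq_zero (convex_ball k₀ δ).isPreconnected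
    (fun k hk ↦ (hderiv z.1 hz.1 k hk).differentiableAt.differentiableWithinAt)
    (fun k hk ↦ (hderiv z.1 hz.1 k hk).fderiv) hz.2 (Metric.mem_ball_self hδ)

theorem eventually_contDiffAt_symm {F F' : Type*} [NormedAddCommGroup F] [NormedSpace ℝ F]
    [CompleteSpace F] [NormedAddCommGroup F'] [NormedSpace ℝ F'] {H : OpenPartialHomeomorph F F'}
    {b : F} (hb : b ∈ H.source) (hH : ∀ᶠ b' in 𝓝 b, ContDiffAt ℝ ∞ H b')
    (hinv : (fderiv ℝ H b).IsInvertible) : ∀ᶠ z in 𝓝 (H b), ContDiffAt ℝ ∞ H.symm z := by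
  have hinv' : ∀ᶠ b' in 𝓝 b, (fderiv ℝ H b').IsInvertible := by
    obtain ⟨A, hA⟩ := hinv
    refine (hH.self_of_nhds.continuousAt_fderiv (by simp)).eventually ?_
    rw [← hA]
    exact ContinuousLinearEquiv.nhds A
  filter_upwards [H.open_target.mem_nhds (H.map_source hb),
    (H.tendsto_symm hb).eventually (hH.and hinv')] with z hz ⟨hsmooth, A, hA⟩
  refine H.contDiffAt_symm hz (f₀' := A) ?_ hsmooth
  rw [hA]
  exact (hsmooth.differentiableAt (by simp)).hasFDerivAt

variable {E : Type*} [NormedAddCommGroup E] [NormedSpace ℝ E]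
  {N : Type*} [TopologicalSpace N] [ChartedSpace E N]
  {E' : Type*} [NormedAddCommGroup E'] [NormedSpace ℝ E']
  {N' : Type*} [TopologicalSpace N'] [ChartedSpace E' N']

/-- The model space `im L × ker L` in which a map with differential `L` is straightened. -/
abbrev RangeProdKer (L : E →L[ℝ] E') : Type _ := L.range × L.ker

variable (E E') in
/-- A chart of `N` at `p` with values in `im d_p f × ker d_p f` whose two coordinates are, in the
preferred charts at `f p` and `p`, a projection `P` of `f` onto `im d_p f` and a projection `Q` onto
`ker d_p f`. It straightens `f` when the rank of `f` is constant. -/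
structure RankChart (f : N → N') (p : N) where
  chart : OpenPartialHomeomorph N (RangeProdKer (modelDeriv E E' f p))
  P : E' →L[ℝ] (modelDeriv E E' f p).range
  Q : E →L[ℝ] (modelDeriv E E' f p).ker
  mem_source : p ∈ chart.source
  eventually_chart_eq : ∀ᶠ z in 𝓝 p, chart z = (P (chartAt E' (f p) (f z)), Q (chartAt E p z))
  smoothNear_symm : SmoothNear (RangeProdKer (modelDeriv E E' f p)) E chart.symm (chart p)

theorem RankChart.eventually_symm_chart {f : N → N'} {p : N} (χ : RankChart E E' f p) :
    ∀ᶠ z in 𝓝 p, χ.chart.symm (χ.P (chartAt E' (f p) (f z)), χ.Q (chartAt E p z)) = z := by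
  filter_upwards [χ.eventually_chart_eq, χ.chart.open_source.mem_nhds χ.mem_source] with z hz hs
  rw [← hz, χ.chart.left_inv hs]

theorem exists_rankChart_of_contDiffAt [FiniteDimensional ℝ E] {f : E → E'} {b : E}
    (hf : ∀ᶠ b' in 𝓝 b, ContDiffAt ℝ ∞ f b') :
    ∃ (H : OpenPartialHomeomorph E (RangeProdKer (fderiv ℝ f b)))
      (P : E' →L[ℝ] (fderiv ℝ f b).range) (Q : E →L[ℝ] (fderiv ℝ f b).ker), b ∈ H.source ∧
      (∀ b', H b' = (P (f b'), Q b')) ∧ ∀ᶠ y in 𝓝 (H b), ContDiffAt ℝ ∞ H.symm y := by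
  set A := fderiv ℝ f b
  obtain ⟨P, hP⟩ := Submodule.ClosedComplemented.of_finiteDimensional A.range
  obtain ⟨Q, hQ⟩ := Submodule.ClosedComplemented.of_finiteDimensional A.ker
  have hPA : ∀ u, P (A u) = ⟨A u, u, rfl⟩ := fun u ↦ hP ⟨A u, u, rfl⟩
  have hker : (P.comp A).ker = A.ker := by
    ext u
    exact (congrArg (· = 0) (hPA u)).to_iff.trans Subtype.ext_iff
  let φ : ImplicitFunctionData ℝ E A.range A.ker :=
    { leftFun := P ∘ f
      leftDeriv := P.comp A
      rightFun := Q
      rightDeriv := Q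
      pt := b
      hasStrictFDerivAt_leftFun := P.hasStrictFDerivAt.comp b
        (hf.self_of_nhds.hasStrictFDerivAt (by simp))
      hasStrictFDerivAt_rightFun := Q.hasStrictFDerivAt
      range_leftDeriv := LinearMap.range_eq_top.2 fun ⟨_, u, hu⟩ ↦
        ⟨u, (hPA u).trans (Subtype.ext hu)⟩
      range_rightDeriv := LinearMap.range_eq_top.2 fun κ ↦ ⟨κ, hQ κ⟩
      isCompl_ker := by rw [hker]; exact LinearMap.isCompl_of_proj hQ }
  refine ⟨φ.toOpenPartialHomeomorph, P, Q, φ.pt_mem_toOpenPartialHomeomorph_source, fun _ ↦ rfl,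
    eventually_contDiffAt_symm φ.pt_mem_toOpenPartialHomeomorph_source ?_
      φ.isInvertible_fderiv_prodFun⟩
  exact hf.mono fun b' hb' ↦ (P.contDiff.contDiffAt.comp b' hb').prodMk Q.contDiff.contDiffAt

theorem modelDeriv_eq_fderiv_chart {f : N → N'} {p : N}
    (hf : MDifferentiableAt 𝓘(ℝ, E) 𝓘(ℝ, E') f p) :
    modelDeriv E E' f p =
      fderiv ℝ (chartAt E' (f p) ∘ f ∘ (chartAt E p).symm) (chartAt E p p) := by
  rw [modelDeriv, hf.mfderiv]
  simp only [writtenInExtChartAt, mfld_simps, fderivWithin_univ]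

section ChartAt

variable [IsManifold 𝓘(ℝ, E) ∞ N]

theorem smoothNear_chartAt {p z : N} (hz : z ∈ (chartAt E p).source) :
    SmoothNear E E (chartAt E p) z :=
  eventually_of_mem ((chartAt E p).open_source.mem_nhds hz) fun _ hz' ↦
    contMDiffAt_of_mem_maximalAtlas (IsManifold.chart_mem_maximalAtlas p) hz'

theorem smoothNear_chartAt_symm {p : N} {y : E} (hy : y ∈ (chartAt E p).target) :
    SmoothNear E E (chartAt E p).symm y :=
  eventually_of_mem ((chartAt E p).open_target.mem_nhds hy) fun _ hy' ↦
    contMDiffAt_symm_of_mem_maximalAtlas (IsManifold.chart_mem_maximalAtlas p) hy'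

theorem modelDeriv_chartAt_symm_comp {p z : N} (hz : z ∈ (chartAt E p).source) :
    (modelDeriv E E (chartAt E p).symm (chartAt E p z)).comp (modelDeriv E E (chartAt E p) z) =
      ContinuousLinearMap.id ℝ E := by
  rw [← modelDeriv_comp z
    (smoothNear_chartAt_symm ((chartAt E p).map_source hz)).mdifferentiableAt
    (smoothNear_chartAt hz).mdifferentiableAt, ← modelDeriv_id z]
  exact modelDeriv_congr (eventually_of_mem ((chartAt E p).open_source.mem_nhds hz)
    fun _ hz' ↦ (chartAt E p).left_inv hz')

theorem modelDeriv_chartAt_self (p : N) :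
    modelDeriv E E (chartAt E p) p = ContinuousLinearMap.id ℝ E := by
  rw [modelDeriv_eq_fderiv_chart (smoothNear_chartAt (mem_chart_source E p)).mdifferentiableAt,
    ← fderiv_id (x := chartAt E p p)]
  refine EventuallyEq.fderiv_eq (eventually_of_mem (chart_target_mem_nhds E p) fun y hy ↦ ?_)
  simp only [chartAt_self_eq, mfld_simps, (chartAt E p).right_inv hy]

end ChartAt

variable [IsManifold 𝓘(ℝ, E') ∞ N'] [FiniteDimensional ℝ E] {f : N → N'} {p : N}

theorem RankChart.eventually_apply_symm (χ : RankChart E E' f p) (hf : SmoothNear E E' f p)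
    (hrank : IsLocalMax (mrank E E' f) p) :
    ∀ᶠ y in 𝓝 (χ.chart p), f (χ.chart.symm y) = f (χ.chart.symm (y.1, (χ.chart p).2)) := by
  set ψ := chartAt E' (f p)
  have htendsto : Tendsto χ.chart.symm (𝓝 (χ.chart p)) (𝓝 p) := χ.chart.tendsto_symm χ.mem_source
  have hψ : ∀ᶠ z in 𝓝 p, f z ∈ ψ.source :=
    hf.continuousAt.eventually (chart_source_mem_nhds E' (f p))
  have hsmooth : ∀ᶠ y in 𝓝 (χ.chart p),
      MDifferentiableAt 𝓘(ℝ, RangeProdKer (modelDeriv E E' f p)) 𝓘(ℝ, E) χ.chart.symm y :=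
    χ.smoothNear_symm.eventually_nhds.mono fun _ hy ↦ SmoothNear.mdifferentiableAt hy
  have hψf : ∀ᶠ z in 𝓝 p, SmoothNear E E' f z ∧ SmoothNear E E' (ψ ∘ f) z := by
    filter_upwards [hf.eventually_nhds, hψ] with z hz hzψ
    exact ⟨hz, (smoothNear_chartAt hzψ).comp hz⟩
  have hstraight : ∀ᶠ y in 𝓝 (χ.chart p), ψ (f (χ.chart.symm y)) =
      ψ (f (χ.chart.symm (y.1, (χ.chart p).2))) := by
    refine eventually_eq_apply_fst_of_finrank_range_fderiv_le (f := (ψ ∘ f) ∘ χ.chart.symm)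
      (P := χ.P) ?_ ?_ ?_
    · filter_upwards [hsmooth, htendsto.eventually hψf] with y hy hz
      exact (hz.2.mdifferentiableAt.comp y hy).differentiableAt
    · filter_upwards [htendsto.eventually χ.eventually_chart_eq,
        χ.chart.open_target.mem_nhds (χ.chart.map_source χ.mem_source)] with y hy hyt
      rw [χ.chart.right_inv hyt] at hy
      exact (congrArg Prod.fst hy).symm
    · filter_upwards [hsmooth, htendsto.eventually (hψf.and (hψ.and hrank))]
        with y hy hz'
      obtain ⟨⟨hz, hψz⟩, hzψ, hzrank⟩ := hz'
      rw [← modelDeriv_eq_fderiv]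
      calc _ ≤ mrank E E' (ψ ∘ f) (χ.chart.symm y) := mrank_comp_le_left y hψz.mdifferentiableAt hy
        _ ≤ mrank E E' f (χ.chart.symm y) :=
          mrank_comp_le_right _ (smoothNear_chartAt hzψ).mdifferentiableAt hz.mdifferentiableAt
        _ ≤ mrank E E' f p := hzrank
  have hfst : Tendsto (fun y : RangeProdKer (modelDeriv E E' f p) ↦ (y.1, (χ.chart p).2))
      (𝓝 (χ.chart p)) (𝓝 (χ.chart p)) :=
    (continuous_fst.prodMk continuous_const).tendsto' _ _ rfl
  filter_upwards [hstraight, htendsto.eventually hψ, (htendsto.comp hfst).eventually hψ]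
    with y hy hs hs'
  exact ψ.injOn hs hs' hy

variable [IsManifold 𝓘(ℝ, E) ∞ N]

theorem SmoothNear.nonempty_rankChart (hf : SmoothNear E E' f p) :
    Nonempty (RankChart E E' f p) := by
  have hsymm : (chartAt E p).symm (chartAt E p p) = p :=
    (chartAt E p).left_inv (mem_chart_source E p)
  have hchart : SmoothNear E E' (chartAt E' (f p) ∘ f ∘ (chartAt E p).symm) (chartAt E p p) := by
    refine SmoothNear.comp (smoothNear_chartAt ?_)
      (SmoothNear.comp (by rwa [hsymm]) (smoothNear_chartAt_symm (mem_chart_target E p)))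
    simp only [Function.comp_apply, hsymm, mem_chart_source]
  obtain ⟨H, P, Q, hH, hHeq, hHs⟩ :
      ∃ (H : OpenPartialHomeomorph E (RangeProdKer (modelDeriv E E' f p)))
        (P : E' →L[ℝ] (modelDeriv E E' f p).range) (Q : E →L[ℝ] (modelDeriv E E' f p).ker),
        chartAt E p p ∈ H.source ∧
        (∀ y, H y = (P ((chartAt E' (f p) ∘ f ∘ (chartAt E p).symm) y), Q y)) ∧
        ∀ᶠ y in 𝓝 (H (chartAt E p p)), ContDiffAt ℝ ∞ H.symm y := by
    rw [modelDeriv_eq_fderiv_chart hf.mdifferentiableAt]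
    exact exists_rankChart_of_contDiffAt (hchart.mono fun _ hy ↦ hy.contDiffAt)
  refine ⟨⟨(chartAt E p).trans H, P, Q, ?_, ?_, ?_⟩⟩
  · simpa only [mfld_simps] using hH
  · filter_upwards [chart_source_mem_nhds E p] with z hz
    simp only [OpenPartialHomeomorph.coe_trans, Function.comp_apply, hHeq,
      (chartAt E p).left_inv hz]
  · refine SmoothNear.comp (k := (chartAt E p).symm) (f := H.symm) (smoothNear_chartAt_symm ?_)
      (hHs.mono fun y hy ↦ hy.contMDiffAt)
    simp only [mfld_simps, H.left_inv hH]

end ConstantRank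

section FiberRetraction

variable {E : Type*} [NormedAddCommGroup E] [NormedSpace ℝ E]
  {N : Type*} [TopologicalSpace N] [ChartedSpace E N]
  {E' : Type*} [NormedAddCommGroup E'] [NormedSpace ℝ E']
  {N' : Type*} [TopologicalSpace N'] [ChartedSpace E' N']

variable (E E') in
/-- `lam` is a smooth retraction, near `p`, of a neighbourhood of `p` onto the fibre of `f` through
`p`, whose differential at `p` fixes `ker d_p f`. -/
structure IsFiberRetractionAt (f : N → N') (p : N) (lam : N → N) : Prop where
  smoothNear : SmoothNear E E lam p
  eventually_apply : ∀ᶠ z in 𝓝 p, f (lam z) = f p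
  eventually_eq_self : ∀ᶠ z in 𝓝 p, f z = f p → lam z = z
  modelDeriv_apply : ∀ u, modelDeriv E E' f p u = 0 → modelDeriv E E lam p u = u

theorem IsFiberRetractionAt.apply_self {f : N → N'} {p : N} {lam : N → N}
    (hlam : IsFiberRetractionAt E E' f p lam) : lam p = p :=
  hlam.eventually_eq_self.self_of_nhds rfl

theorem hasMFDerivAt_prodMk_space {F F' : Type*} [NormedAddCommGroup F] [NormedSpace ℝ F]
    [NormedAddCommGroup F'] [NormedSpace ℝ F'] {f : N → F} {k : N → F'} {z : N} {A : E →L[ℝ] F}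
    {B : E →L[ℝ] F'} (hf : HasMFDerivAt 𝓘(ℝ, E) 𝓘(ℝ, F) f z A)
    (hk : HasMFDerivAt 𝓘(ℝ, E) 𝓘(ℝ, F') k z B) :
    HasMFDerivAt 𝓘(ℝ, E) 𝓘(ℝ, F × F') (fun z ↦ (f z, k z)) z (A.prod B) :=
  ⟨hf.1.prodMk hk.1, hf.2.prodMk hk.2⟩

namespace RankChart

variable [IsManifold 𝓘(ℝ, E) ∞ N] {f : N → N'} {p : N}

theorem smoothNear_prodMk_chartAt (χ : RankChart E E' f p) (a : (modelDeriv E E' f p).range) :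
    SmoothNear E (RangeProdKer (modelDeriv E E' f p)) (fun z ↦ (a, χ.Q (chartAt E p z))) p :=
  SmoothNear.comp (k := fun y ↦ (a, χ.Q y))
    (smoothNear_of_contDiff (contDiff_const.prodMk χ.Q.contDiff) _)
    (smoothNear_chartAt (mem_chart_source E p))

variable [IsManifold 𝓘(ℝ, E') ∞ N']

theorem modelDeriv_symm_comp_prodMk_apply (χ : RankChart E E' f p) (hf : SmoothNear E E' f p)
    {u : E} (hu : modelDeriv E E' f p u = 0) :
    modelDeriv E E (fun z ↦ χ.chart.symm (χ.P (chartAt E' (f p) (f p)), χ.Q (chartAt E p z))) p u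
      = u := by
  set φ := chartAt E p
  set ψ := chartAt E' (f p)
  have hφ : HasMFDerivAt 𝓘(ℝ, E) 𝓘(ℝ, _) (χ.Q ∘ φ) p (χ.Q.comp (modelDeriv E E φ p)) :=
    χ.Q.hasMFDerivAt.comp p
      (hasMFDerivAt_modelDeriv (smoothNear_chartAt (mem_chart_source E p)).mdifferentiableAt)
  have hψ : HasMFDerivAt 𝓘(ℝ, E) 𝓘(ℝ, _) (χ.P ∘ ψ ∘ f) p
      (χ.P.comp ((modelDeriv E' E' ψ (f p)).comp (modelDeriv E E' f p))) :=
    χ.P.hasMFDerivAt.comp p ((hasMFDerivAt_modelDeriv (smoothNear_chartAt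
      (mem_chart_source E' (f p))).mdifferentiableAt).comp p
        (hasMFDerivAt_modelDeriv hf.mdifferentiableAt))
  have hσ : HasMFDerivAt 𝓘(ℝ, RangeProdKer (modelDeriv E E' f p)) 𝓘(ℝ, E) χ.chart.symm
      (χ.P (ψ (f p)), χ.Q (φ p)) _ :=
    χ.eventually_chart_eq.self_of_nhds ▸
      hasMFDerivAt_modelDeriv χ.smoothNear_symm.mdifferentiableAt
  have hid := (hσ.comp p (hasMFDerivAt_prodMk_space hψ hφ)).congr_of_eventuallyEq
    (χ.eventually_symm_chart.mono fun z hz ↦ hz.symm)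
  have hlam := hσ.comp p
    (hasMFDerivAt_prodMk_space (hasMFDerivAt_const (χ.P (ψ (f p))) p) hφ)
  have hu' := DFunLike.congr_fun (hasMFDerivAt_unique hid (hasMFDerivAt_id p)) u
  have hzero : χ.P (modelDeriv E' E' ψ (f p) (modelDeriv E E' f p u)) = 0 := by
    rw [hu, map_zero, map_zero]
  exact (DFunLike.congr_fun hlam.mfderiv u).trans
    ((congrArg (fun a ↦ modelDeriv _ E χ.chart.symm _ (a, χ.Q (modelDeriv E E φ p u)))
      hzero.symm).trans hu')

theorem isFiberRetractionAt [FiniteDimensional ℝ E] (χ : RankChart E E' f p)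
    (hf : SmoothNear E E' f p) (hrank : IsLocalMax (mrank E E' f) p) :
    IsFiberRetractionAt E E' f p
      fun z ↦ χ.chart.symm (χ.P (chartAt E' (f p) (f p)), χ.Q (chartAt E p z)) := by
  have hp : χ.chart p = (χ.P (chartAt E' (f p) (f p)), χ.Q (chartAt E p p)) :=
    χ.eventually_chart_eq.self_of_nhds
  have hsmooth := χ.smoothNear_prodMk_chartAt (χ.P (chartAt E' (f p) (f p)))
  refine ⟨SmoothNear.comp (hp ▸ χ.smoothNear_symm) hsmooth, ?_, ?_,
    fun u ↦ χ.modelDeriv_symm_comp_prodMk_apply hf⟩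
  · filter_upwards [hsmooth.continuousAt.eventually (hp ▸ χ.eventually_apply_symm hf hrank)]
      with z hz
    rw [hz, ← hp, χ.chart.left_inv χ.mem_source]
  · filter_upwards [χ.eventually_symm_chart] with z hz hfz
    rwa [hfz] at hz

end RankChart

variable [IsManifold 𝓘(ℝ, E) ∞ N] [IsManifold 𝓘(ℝ, E') ∞ N'] [FiniteDimensional ℝ E]
  {f : N → N'} {p : N}

theorem SmoothNear.exists_isFiberRetractionAt (hf : SmoothNear E E' f p)
    (hrank : IsLocalMax (mrank E E' f) p) : ∃ lam, IsFiberRetractionAt E E' f p lam :=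
  let ⟨χ⟩ := hf.nonempty_rankChart
  ⟨_, χ.isFiberRetractionAt hf hrank⟩

theorem SmoothNear.exists_section_onto_image (hf : SmoothNear E E' f p)
    (hrank : IsLocalMax (mrank E E' f) p) :
    ∃ τ : N' → N, SmoothNear E' E τ (f p) ∧ τ (f p) = p ∧ ∀ᶠ z in 𝓝 p, f (τ (f z)) = f z := by
  obtain ⟨χ⟩ := hf.nonempty_rankChart
  have hp : χ.chart p = (χ.P (chartAt E' (f p) (f p)), χ.Q (chartAt E p p)) :=
    χ.eventually_chart_eq.self_of_nhds
  refine ⟨fun y ↦ χ.chart.symm (χ.P (chartAt E' (f p) y), χ.Q (chartAt E p p)),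
    SmoothNear.comp (hp ▸ χ.smoothNear_symm) ?_, ?_, ?_⟩
  · exact SmoothNear.comp (k := fun y ↦ (χ.P y, χ.Q (chartAt E p p)))
      (smoothNear_of_contDiff (χ.P.contDiff.prodMk contDiff_const) _)
      (smoothNear_chartAt (mem_chart_source E' (f p)))
  · exact χ.eventually_symm_chart.self_of_nhds
  · filter_upwards [χ.eventually_chart_eq, χ.chart.open_source.mem_nhds χ.mem_source,
      (χ.chart.continuousAt χ.mem_source).eventually (χ.eventually_apply_symm hf hrank)]
      with z hz hzs hzf
    rw [χ.chart.left_inv hzs, hz, hp] at hzf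
    exact hzf.symm

end FiberRetraction

section Curves

variable {E : Type*} [NormedAddCommGroup E] [NormedSpace ℝ E]
  {N : Type*} [TopologicalSpace N] [ChartedSpace E N]
  {E' : Type*} [NormedAddCommGroup E'] [NormedSpace ℝ E']
  {N' : Type*} [TopologicalSpace N'] [ChartedSpace E' N']

theorem modelDeriv_mem_submanifoldTangentSpace_of_curve {S : Set N} {γ : ℝ → N}
    (hγ : SmoothNear ℝ E γ 0) (hS : ∀ᶠ r in 𝓝 0, γ r ∈ S) :
    modelDeriv ℝ E γ 0 1 ∈ submanifoldTangentSpace (E := E) S (γ 0) := by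
  obtain ⟨ε, hε, hball⟩ := Metric.eventually_nhds_iff_ball.1 (hγ.and hS)
  rw [Real.ball_eq_Ioo, zero_sub, zero_add] at hball
  exact Submodule.subset_span ⟨γ, ε, hε, fun r hr ↦ (hball r hr).1.contMDiffWithinAt,
    fun r hr ↦ (hball r hr).2, rfl⟩

theorem submanifoldTangentSpace_le {S : Set N} {p : N} {W : Submodule ℝ E}
    (h : ∀ γ : ℝ → N, SmoothNear ℝ E γ 0 → γ 0 = p → (∀ᶠ r in 𝓝 0, γ r ∈ S) →
      modelDeriv ℝ E γ 0 1 ∈ W) :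
    submanifoldTangentSpace (E := E) S p ≤ W := by
  refine Submodule.span_le.2 ?_
  rintro v ⟨γ, ε, hε, hγ, hγS, hv⟩
  obtain rfl : γ 0 = p := congrArg Bundle.TotalSpace.proj hv
  obtain rfl := tangentVector_ext (N := N) hv
  have hmem : Ioo (-ε) ε ∈ 𝓝 (0 : ℝ) := Ioo_mem_nhds (neg_lt_zero.2 hε) hε
  refine h γ ?_ rfl (eventually_of_mem hmem hγS)
  exact eventually_of_mem hmem fun r hr ↦ hγ.contMDiffAt (isOpen_Ioo.mem_nhds hr)

theorem submanifoldTangentSpace_le_ker {S : Set N} {p : N} {f : N → N'} {c : N'}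
    (hf : MDifferentiableAt 𝓘(ℝ, E) 𝓘(ℝ, E') f p) (hS : ∀ z ∈ S, f z = c) :
    submanifoldTangentSpace (E := E) S p ≤ (modelDeriv E E' f p).ker := by
  refine submanifoldTangentSpace_le fun γ hγ hγp hγS ↦ ?_
  subst hγp
  have hzero := modelDeriv_eq_zero_of_eventually_eq (E := ℝ) (E' := E') (f := f ∘ γ)
    (hγS.mono fun r hr ↦ hS _ hr)
  rw [modelDeriv_comp 0 hf hγ.mdifferentiableAt] at hzero
  exact DFunLike.congr_fun hzero 1

variable [IsManifold 𝓘(ℝ, E) ∞ N]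

theorem exists_curve_with_velocity (p : N) (u : E) :
    ∃ c : ℝ → N, SmoothNear ℝ E c 0 ∧ c 0 = p ∧ modelDeriv ℝ E c 0 1 = u := by
  set φ := chartAt E p
  have hφs : SmoothNear E E φ.symm (φ p) := smoothNear_chartAt_symm (mem_chart_target E p)
  set ℓ : ℝ → E := fun r ↦ φ p + r • modelDeriv E E φ p u
  have hℓ : HasDerivAt ℓ (modelDeriv E E φ p u) 0 := by
    simpa only [one_smul] using ((hasDerivAt_id' (0 : ℝ)).smul_const _).const_add (φ p)
  have hℓ0 : ℓ 0 = φ p := by simp [ℓ]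
  have hℓs : SmoothNear ℝ E ℓ 0 := smoothNear_of_contDiff (by fun_prop) 0
  refine ⟨φ.symm ∘ ℓ, SmoothNear.comp (by rwa [hℓ0]) hℓs, ?_, ?_⟩
  · rw [Function.comp_apply, hℓ0, φ.left_inv (mem_chart_source E p)]
  · rw [modelDeriv_comp 0 (by rw [hℓ0]; exact hφs.mdifferentiableAt) hℓs.mdifferentiableAt, hℓ0,
      modelDeriv_eq_fderiv, ContinuousLinearMap.comp_apply, fderiv_apply_one_eq_deriv, hℓ.deriv]
    exact DFunLike.congr_fun (modelDeriv_chartAt_symm_comp (mem_chart_source E p)) u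

theorem modelDeriv_mem_submanifoldTangentSpace {f : N → N'} {S : Set N'} {p : N}
    (hf : SmoothNear E E' f p) (hS : ∀ᶠ z in 𝓝 p, f z ∈ S) (u : E) :
    modelDeriv E E' f p u ∈ submanifoldTangentSpace (E := E') S (f p) := by
  obtain ⟨c, hc, rfl, rfl⟩ := exists_curve_with_velocity p u
  have hmem := modelDeriv_mem_submanifoldTangentSpace_of_curve (hf.comp hc)
    (hc.continuousAt.eventually hS)
  rwa [modelDeriv_comp 0 hf.mdifferentiableAt hc.mdifferentiableAt] at hmem

end Curves

section Fibers

variable {E : Type*} [NormedAddCommGroup E] [NormedSpace ℝ E]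
  {N : Type*} [TopologicalSpace N] [ChartedSpace E N]
  {E' : Type*} [NormedAddCommGroup E'] [NormedSpace ℝ E']
  {N' : Type*} [TopologicalSpace N'] [ChartedSpace E' N']
  {E'' : Type*} [NormedAddCommGroup E''] [NormedSpace ℝ E'']
  {N'' : Type*} [TopologicalSpace N''] [ChartedSpace E'' N'']
  {f : N → N'} {k : N → N''} {p : N} {lam : N → N}

instance [FiniteDimensional ℝ E] : FiniteDimensional ℝ (fiberRange E E' E'' f k p) := by
  unfold fiberRange
  infer_instance

namespace IsFiberRetractionAt

variable (hlam : IsFiberRetractionAt E E' f p lam)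

include hlam

theorem tendsto : Tendsto lam (𝓝 p) (𝓝[f ⁻¹' {f p}] p) :=
  tendsto_nhdsWithin_iff.2
    ⟨by simpa only [hlam.apply_self] using hlam.smoothNear.continuousAt.tendsto,
      hlam.eventually_apply⟩

theorem eventually_range_comp_le (hf : SmoothNear E E' f p) (hk : SmoothNear E E'' k p) :
    ∀ᶠ z in 𝓝 p, (modelDeriv E E'' (k ∘ lam) z).range ≤ fiberRange E E' E'' f k (lam z) := by
  have hlamp : Tendsto lam (𝓝 p) (𝓝 p) := hlam.tendsto.mono_right nhdsWithin_le_nhds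
  filter_upwards [hlam.smoothNear.eventually_nhds, hlam.eventually_apply.eventually_nhds,
    hlamp.eventually hf, hlamp.eventually hk] with z hz hconst hfz hkz
  have hd := SmoothNear.mdifferentiableAt hz
  have hzero := modelDeriv_eq_zero_of_eventually_eq (E := E) (E' := E') (f := f ∘ lam) hconst
  rw [modelDeriv_comp z (hfz.mdifferentiableAt (by simp)) hd] at hzero
  rw [modelDeriv_comp z (hkz.mdifferentiableAt (by simp)) hd]
  rintro _ ⟨u, rfl⟩
  exact ⟨modelDeriv E E lam z u, DFunLike.congr_fun hzero u, rfl⟩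

theorem modelDeriv_comp_apply (hk : SmoothNear E E'' k p) {u : E}
    (hu : modelDeriv E E' f p u = 0) :
    modelDeriv E E'' (k ∘ lam) p u = modelDeriv E E'' k p u := by
  rw [modelDeriv_comp p (by rw [hlam.apply_self]; exact hk.mdifferentiableAt)
    hlam.smoothNear.mdifferentiableAt, ContinuousLinearMap.comp_apply, hlam.modelDeriv_apply u hu,
    hlam.apply_self]

theorem isLocalMax_mrank_comp [FiniteDimensional ℝ E] (hf : SmoothNear E E' f p)
    (hk : SmoothNear E E'' k p)
    (hrank : IsLocalMaxOn (fun z ↦ finrank ℝ (fiberRange E E' E'' f k z)) (f ⁻¹' {f p}) p) :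
    IsLocalMax (mrank E E'' (k ∘ lam)) p := by
  filter_upwards [hlam.eventually_range_comp_le hf hk, hlam.tendsto.eventually hrank]
    with z hz hzrank
  calc mrank E E'' (k ∘ lam) z
      ≤ finrank ℝ (fiberRange E E' E'' f k (lam z)) := Submodule.finrank_mono hz
    _ ≤ finrank ℝ (fiberRange E E' E'' f k p) := hzrank
    _ ≤ mrank E E'' (k ∘ lam) p := Submodule.finrank_mono ?_
  rintro _ ⟨u, hu, rfl⟩
  exact ⟨u, hlam.modelDeriv_comp_apply hk hu⟩

end IsFiberRetractionAt

variable [IsManifold 𝓘(ℝ, E) ∞ N]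

theorem hasDerivAt_chartAt_comp {γ : ℝ → N} {r : ℝ} (hγ : MDifferentiableAt 𝓘(ℝ, ℝ) 𝓘(ℝ, E) γ r) :
    HasDerivAt (chartAt E (γ r) ∘ γ) (modelDeriv ℝ E γ r 1) r := by
  have hchart : MDifferentiableAt 𝓘(ℝ, E) 𝓘(ℝ, E) (chartAt E (γ r)) (γ r) :=
    (smoothNear_chartAt (mem_chart_source E (γ r))).mdifferentiableAt
  have hd := (hchart.comp r hγ).differentiableAt.hasDerivAt
  rwa [← fderiv_apply_one_eq_deriv, ← modelDeriv_eq_fderiv, modelDeriv_comp r hchart hγ,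
    modelDeriv_chartAt_self] at hd

theorem modelDeriv_apply_one_eq_of_frequently_eq {γ δ : ℝ → N} {r₀ : ℝ}
    (hγ : MDifferentiableAt 𝓘(ℝ, ℝ) 𝓘(ℝ, E) γ r₀) (hδ : MDifferentiableAt 𝓘(ℝ, ℝ) 𝓘(ℝ, E) δ r₀)
    (heq : γ r₀ = δ r₀) (hfreq : ∃ᶠ r in 𝓝[≠] r₀, γ r = δ r) :
    modelDeriv ℝ E γ r₀ 1 = modelDeriv ℝ E δ r₀ 1 := by
  by_contra hne
  have hδ' := hasDerivAt_chartAt_comp hδ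
  rw [← heq] at hδ'
  have hev := ((hasDerivAt_chartAt_comp hγ).sub hδ').eventually_ne (c := 0) (sub_ne_zero.2 hne)
  obtain ⟨r, hr, hr'⟩ := (hfreq.and_eventually hev).exists
  exact hr' (by simp only [Pi.sub_apply, Function.comp_apply, hr, sub_self])

variable [FiniteDimensional ℝ E] [IsManifold 𝓘(ℝ, E') ∞ N']
  [IsManifold 𝓘(ℝ, E'') ∞ N'']

theorem ker_inf_ker_le_submanifoldTangentSpace (hf : SmoothNear E E' f p)
    (hk : SmoothNear E E'' k p) (hfrank : IsLocalMax (mrank E E' f) p)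
    (hrank : IsLocalMaxOn (fun z ↦ finrank ℝ (fiberRange E E' E'' f k z)) (f ⁻¹' {f p}) p) :
    (modelDeriv E E' f p).ker ⊓ (modelDeriv E E'' k p).ker ≤
      submanifoldTangentSpace (E := E) (f ⁻¹' {f p} ∩ k ⁻¹' {k p}) p := by
  rintro u ⟨hfu, hku⟩
  obtain ⟨lam, hlam⟩ := hf.exists_isFiberRetractionAt hfrank
  have hklam : SmoothNear E E'' (k ∘ lam) p :=
    SmoothNear.comp (by rwa [hlam.apply_self]) hlam.smoothNear
  obtain ⟨μ, hμ⟩ := hklam.exists_isFiberRetractionAt (hlam.isLocalMax_mrank_comp hf hk hrank)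
  have hlam' : SmoothNear E E lam (μ p) := by rw [hμ.apply_self]; exact hlam.smoothNear
  have hmem := modelDeriv_mem_submanifoldTangentSpace (hlam'.comp hμ.smoothNear)
    (S := f ⁻¹' {f p} ∩ k ⁻¹' {k p}) (by
      filter_upwards [(hμ.tendsto.mono_right nhdsWithin_le_nhds).eventually hlam.eventually_apply,
        hμ.eventually_apply] with z hfz hkz
      rw [Function.comp_apply, Function.comp_apply, hlam.apply_self] at hkz
      exact ⟨hfz, hkz⟩) u
  rwa [modelDeriv_comp p hlam'.mdifferentiableAt hμ.smoothNear.mdifferentiableAt,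
    ContinuousLinearMap.comp_apply,
    hμ.modelDeriv_apply u ((hlam.modelDeriv_comp_apply hk hfu).trans hku), Function.comp_apply,
    hμ.apply_self, hlam.apply_self, hlam.modelDeriv_apply u hfu] at hmem

theorem frequently_of_accPt_graphOn {X : Type*} [TopologicalSpace X] {h : ℝ → X} {I : Set ℝ}
    {r₀ : ℝ} (hacc : AccPt (r₀, h r₀) (𝓟 (I.graphOn h))) {s : Set X} (hs : s ∈ 𝓝 (h r₀)) :
    ∃ᶠ r in 𝓝[≠] r₀, r ∈ I ∧ h r ∈ s := by
  intro hev
  rw [accPt_iff_frequently] at hacc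
  refine hacc ?_
  filter_upwards [continuous_fst.continuousAt.eventually (eventually_nhdsWithin_iff.1 hev),
    continuous_snd.continuousAt.eventually hs]
  rintro _ hr hrs ⟨hne, r, hrI, rfl⟩
  exact hr (fun hrr : r = r₀ ↦ hne (by rw [hrr])) ⟨hrI, hrs⟩

theorem velocity_mem_fiberRange_of_accPt {γ : ℝ → N''} {h : ℝ → N} {I : Set ℝ} {r₀ : ℝ}
    (hr₀ : r₀ ∈ I) (hfh : ∀ r ∈ I, f (h r) = f (h r₀)) (hkh : ∀ r ∈ I, k (h r) = γ r)
    (hacc : AccPt (r₀, h r₀) (𝓟 (I.graphOn h)))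
    (hγ : MDifferentiableAt 𝓘(ℝ, ℝ) 𝓘(ℝ, E'') γ r₀)
    (hf : SmoothNear E E' f (h r₀)) (hk : SmoothNear E E'' k (h r₀))
    (hfrank : IsLocalMax (mrank E E' f) (h r₀))
    (hrank : IsLocalMaxOn (fun z ↦ finrank ℝ (fiberRange E E' E'' f k z))
      (f ⁻¹' {f (h r₀)}) (h r₀)) :
    modelDeriv ℝ E'' γ r₀ 1 ∈ fiberRange E E' E'' f k (h r₀) := by
  obtain ⟨lam, hlam⟩ := hf.exists_isFiberRetractionAt hfrank
  have hF : SmoothNear E E'' (k ∘ lam) (h r₀) :=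
    SmoothNear.comp (by rwa [hlam.apply_self]) hlam.smoothNear
  obtain ⟨τ, hτ, hτp, hFτ⟩ :=
    hF.exists_section_onto_image (hlam.isLocalMax_mrank_comp hf hk hrank)
  have hFγ : (k ∘ lam) (h r₀) = γ r₀ := by rw [Function.comp_apply, hlam.apply_self, hkh r₀ hr₀]
  rw [hFγ] at hτ hτp
  have hτγ : MDifferentiableAt 𝓘(ℝ, ℝ) 𝓘(ℝ, E) (τ ∘ γ) r₀ := hτ.mdifferentiableAt.comp r₀ hγ
  have hF' : MDifferentiableAt 𝓘(ℝ, E) 𝓘(ℝ, E'') (k ∘ lam) ((τ ∘ γ) r₀) := by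
    rw [Function.comp_apply, hτp]
    exact hF.mdifferentiableAt
  have hfreq : ∃ᶠ r in 𝓝[≠] r₀, γ r = ((k ∘ lam) ∘ τ ∘ γ) r := by
    refine (frequently_of_accPt_graphOn hacc (hlam.eventually_eq_self.and hFτ)).mono ?_
    rintro r ⟨hrI, hlamr, hFr⟩
    have hFγr : (k ∘ lam) (h r) = γ r := by
      rw [Function.comp_apply, hlamr (hfh r hrI), hkh r hrI]
    rw [hFγr] at hFr
    exact hFr.symm
  rw [modelDeriv_apply_one_eq_of_frequently_eq hγ (hF'.comp r₀ hτγ)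
    (by simp only [Function.comp_apply, hτp]; exact hFγ.symm) hfreq, modelDeriv_comp r₀ hF' hτγ,
    Function.comp_apply, hτp]
  have hrange := (hlam.eventually_range_comp_le hf hk).self_of_nhds
  rw [hlam.apply_self] at hrange
  exact hrange ⟨_, rfl⟩

end Fibers

section Limits

variable {E : Type*} [NormedAddCommGroup E] [NormedSpace ℝ E]
  {N : Type*} [TopologicalSpace N] [ChartedSpace E N]
  {E' : Type*} [NormedAddCommGroup E'] [NormedSpace ℝ E']
  {N' : Type*} [TopologicalSpace N'] [ChartedSpace E' N']

theorem countable_setOf_mem_not_accPt {X : Type*} [TopologicalSpace X]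
    [SecondCountableTopology X] (S : Set X) : {x ∈ S | ¬ AccPt x (𝓟 S)}.Countable := by
  have : DiscreteTopology {x ∈ S | ¬ AccPt x (𝓟 S)} := discreteTopology_of_noAccPts
    fun x hx hacc ↦ hx.2 (hacc.mono (principal_mono.2 (sep_subset _ _)))
  exact TopologicalSpace.separableSpace_iff_countable.1 inferInstance

theorem countable_setOf_not_accPt_graphOn {X : Type*} [TopologicalSpace X]
    [SecondCountableTopology X] (h : ℝ → X) (I : Set ℝ) :
    {r ∈ I | ¬ AccPt (r, h r) (𝓟 (I.graphOn h))}.Countable :=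
  MapsTo.countable_of_injOn (f := fun r ↦ (r, h r))
    (t := {q ∈ I.graphOn h | ¬ AccPt q (𝓟 (I.graphOn h))}) (fun r hr ↦ ⟨⟨r, hr.1, rfl⟩, hr.2⟩)
    (fun _ _ _ _ hrr' ↦ congrArg Prod.fst hrr') (countable_setOf_mem_not_accPt (I.graphOn h))

theorem mem_range_of_frequently [FiniteDimensional ℝ E] {X : Type*} [TopologicalSpace X] {x₀ : X}
    {L : X → E →L[ℝ] E'} {w : X → E'} (hL : ContinuousAt L x₀) (hw : ContinuousAt w x₀)
    (h : ∃ᶠ x in 𝓝 x₀, w x ∈ (L x).range ∧ finrank ℝ (L x).range ≤ finrank ℝ (L x₀).range) :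
    w x₀ ∈ (L x₀).range := by
  by_contra hnot
  set b := Module.finBasis ℝ (L x₀).range
  choose u hu using fun i ↦ (b i).2
  have hbasis : LinearIndependent ℝ fun i ↦ L x₀ (u i) := by
    have hb := b.linearIndependent.map' (L x₀).range.subtype (Submodule.ker_subtype _)
    rwa [show (L x₀).range.subtype ∘ b = fun i ↦ L x₀ (u i) from funext fun i ↦ (hu i).symm] at hb
  set fam : X → Option (Fin (finrank ℝ (L x₀).range)) → E' := fun x o ↦
    o.elim (w x) fun i ↦ L x (u i)
  have hfam : ContinuousAt fam x₀ := continuousAt_pi.2 fun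
    | none => hw
    | some _ => hL.clm_apply continuousAt_const
  have hli₀ : LinearIndependent ℝ (fam x₀) := by
    refine linearIndependent_option.2 ⟨hbasis, fun hmem ↦ hnot (Submodule.span_le.2 ?_ hmem)⟩
    rintro _ ⟨i, rfl⟩
    exact ⟨u i, rfl⟩
  obtain ⟨x, ⟨hx, hrank⟩, hli⟩ := (h.and_eventually (hfam.eventually hli₀.eventually)).exists
  have hmem : ∀ o, fam x o ∈ (L x).range
    | none => hx
    | some i => ⟨u i, rfl⟩
  have hcard := (LinearIndependent.of_comp (v := fun o ↦ ⟨fam x o, hmem o⟩)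
    (L x).range.subtype hli).fintype_card_le_finrank
  simp only [Fintype.card_option, Fintype.card_fin] at hcard
  omega

variable [IsManifold 𝓘(ℝ, E) ∞ N]

theorem range_fderiv_comp_chartAt_symm {F : N → E'} {p z : N} (hz : z ∈ (chartAt E p).source)
    (hF : MDifferentiableAt 𝓘(ℝ, E) 𝓘(ℝ, E') F z) :
    (fderiv ℝ (F ∘ (chartAt E p).symm) (chartAt E p z)).range = (modelDeriv E E' F z).range := by
  have hsymm := (chartAt E p).left_inv hz
  rw [← modelDeriv_eq_fderiv, modelDeriv_comp _ (by rwa [hsymm])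
    (smoothNear_chartAt_symm ((chartAt E p).map_source hz)).mdifferentiableAt, hsymm]
  refine (LinearMap.range_comp_le_range _ _).antisymm ?_
  rintro _ ⟨u, rfl⟩
  exact ⟨modelDeriv E E (chartAt E p) z u,
    congrArg (modelDeriv E E' F z) (DFunLike.congr_fun (modelDeriv_chartAt_symm_comp hz) u)⟩

theorem mem_range_modelDeriv_of_frequently [FiniteDimensional ℝ E] {F : N → E'} {X : Type*}
    [TopologicalSpace X] {x₀ : X} {z : X → N} {w : X → E'} (hF : SmoothNear E E' F (z x₀))
    (hz : ContinuousAt z x₀) (hw : ContinuousAt w x₀)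
    (h : ∃ᶠ x in 𝓝 x₀,
      w x ∈ (modelDeriv E E' F (z x)).range ∧ mrank E E' F (z x) ≤ mrank E E' F (z x₀)) :
    w x₀ ∈ (modelDeriv E E' F (z x₀)).range := by
  set φ := chartAt E (z x₀)
  have hF' : SmoothNear E E' (F ∘ φ.symm) (φ (z x₀)) :=
    SmoothNear.comp (by rwa [φ.left_inv (mem_chart_source E _)])
      (smoothNear_chartAt_symm (mem_chart_target E _))
  have hL : ContinuousAt (fun x ↦ fderiv ℝ (F ∘ φ.symm) (φ (z x))) x₀ :=
    ContinuousAt.comp (f := φ ∘ z) (hF'.contMDiffAt.contDiffAt.continuousAt_fderiv (by simp))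
      ((φ.continuousAt (mem_chart_source E _)).comp hz)
  have hrange : ∀ᶠ x in 𝓝 x₀, (fderiv ℝ (F ∘ φ.symm) (φ (z x))).range =
      (modelDeriv E E' F (z x)).range := by
    filter_upwards [hz.eventually (chart_source_mem_nhds E (z x₀)),
      hz.eventually hF.eventually_nhds] with x hx hFx
    exact range_fderiv_comp_chartAt_symm hx (SmoothNear.mdifferentiableAt hFx)
  rw [← hrange.self_of_nhds]
  refine mem_range_of_frequently hL hw ((h.and_eventually hrange).mono ?_)
  rintro x ⟨⟨hwx, hrank⟩, hx⟩
  rw [hx, hrange.self_of_nhds]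
  exact ⟨hwx, hrank⟩

end Limits

section CommonSection

variable {E : Type*} [NormedAddCommGroup E] [NormedSpace ℝ E]
  {N : Type*} [TopologicalSpace N] [ChartedSpace E N]
  {E' : Type*} [NormedAddCommGroup E'] [NormedSpace ℝ E']
  {N' : Type*} [TopologicalSpace N'] [ChartedSpace E' N']
  {f k : N → N'} {σ : N' → N}

theorem fiberRange_eq_range_sub_of_rightInverse {x : N'} (hfσ : Function.RightInverse σ f)
    (hkσ : Function.RightInverse σ k) (hf : MDifferentiableAt 𝓘(ℝ, E) 𝓘(ℝ, E') f (σ x))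
    (hk : MDifferentiableAt 𝓘(ℝ, E) 𝓘(ℝ, E') k (σ x))
    (hσ : MDifferentiableAt 𝓘(ℝ, E') 𝓘(ℝ, E) σ x) :
    fiberRange E E' E' f k (σ x) =
      (modelDeriv E E' k (σ x) - modelDeriv E E' f (σ x)).range := by
  have hfd := modelDeriv_comp x hf hσ
  have hkd := modelDeriv_comp x hk hσ
  rw [hfσ.id, modelDeriv_id] at hfd
  rw [hkσ.id, modelDeriv_id] at hkd
  apply le_antisymm
  · rintro _ ⟨u, hu, rfl⟩
    exact ⟨u, (congrArg (modelDeriv E E' k (σ x) u - ·) hu).trans (sub_zero _)⟩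
  · rintro _ ⟨u, rfl⟩
    set v := modelDeriv E' E σ x (modelDeriv E E' f (σ x) u)
    have hfv : modelDeriv E E' f (σ x) v = modelDeriv E E' f (σ x) u :=
      (DFunLike.congr_fun hfd _).symm
    have hkv : modelDeriv E E' k (σ x) v = modelDeriv E E' f (σ x) u :=
      (DFunLike.congr_fun hkd _).symm
    refine ⟨u - v, LinearMap.mem_ker.2 ?_, ?_⟩
    · exact (map_sub (modelDeriv E E' f (σ x)) u v).trans (by rw [hfv, sub_self])
    · exact (map_sub (modelDeriv E E' k (σ x)) u v).trans (by rw [hkv]; rfl)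

variable [IsManifold 𝓘(ℝ, E') ∞ N']

theorem modelDeriv_chartAt_comp_sub {y : N'} {z : N} (hz : k z = f z)
    (hy : f z ∈ (chartAt E' y).source) (hf : MDifferentiableAt 𝓘(ℝ, E) 𝓘(ℝ, E') f z)
    (hk : MDifferentiableAt 𝓘(ℝ, E) 𝓘(ℝ, E') k z) :
    modelDeriv E E' (chartAt E' y ∘ k - chartAt E' y ∘ f) z =
      (modelDeriv E' E' (chartAt E' y) (f z)).comp (modelDeriv E E' k z - modelDeriv E E' f z) := by
  have hψ : MDifferentiableAt 𝓘(ℝ, E') 𝓘(ℝ, E') (chartAt E' y) (f z) :=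
    (smoothNear_chartAt hy).mdifferentiableAt
  have hψ' : MDifferentiableAt 𝓘(ℝ, E') 𝓘(ℝ, E') (chartAt E' y) (k z) := by rwa [hz]
  have hsub : modelDeriv E E' (chartAt E' y ∘ k - chartAt E' y ∘ f) z =
      modelDeriv E E' (chartAt E' y ∘ k) z - modelDeriv E E' (chartAt E' y ∘ f) z :=
    mfderiv_sub (hψ'.comp z hk) (hψ.comp z hf)
  rw [hsub, modelDeriv_comp z hψ' hk, modelDeriv_comp z hψ hf, hz, ContinuousLinearMap.comp_sub]

theorem range_modelDeriv_chartAt_comp_sub {y x : N'} (hx : x ∈ (chartAt E' y).source)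
    (hfσ : Function.RightInverse σ f) (hkσ : Function.RightInverse σ k)
    (hf : MDifferentiableAt 𝓘(ℝ, E) 𝓘(ℝ, E') f (σ x))
    (hk : MDifferentiableAt 𝓘(ℝ, E) 𝓘(ℝ, E') k (σ x))
    (hσ : MDifferentiableAt 𝓘(ℝ, E') 𝓘(ℝ, E) σ x) :
    (modelDeriv E E' (chartAt E' y ∘ k - chartAt E' y ∘ f) (σ x)).range =
      (fiberRange E E' E' f k (σ x)).map (modelDeriv E' E' (chartAt E' y) x).toLinearMap := by
  rw [modelDeriv_chartAt_comp_sub ((hkσ x).trans (hfσ x).symm) (by rwa [hfσ]) hf hk, hfσ,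
    fiberRange_eq_range_sub_of_rightInverse hfσ hkσ hf hk hσ]
  exact LinearMap.range_comp _ _

theorem velocity_mem_fiberRange_of_frequently [IsManifold 𝓘(ℝ, E) ∞ N] [FiniteDimensional ℝ E]
    (hf : ContMDiff 𝓘(ℝ, E) 𝓘(ℝ, E') ∞ f) (hk : ContMDiff 𝓘(ℝ, E) 𝓘(ℝ, E') ∞ k)
    (hσ : ContMDiff 𝓘(ℝ, E') 𝓘(ℝ, E) ∞ σ) (hfσ : Function.RightInverse σ f)
    (hkσ : Function.RightInverse σ k) {γ : ℝ → N'} {r₀ : ℝ} (hγ : SmoothNear ℝ E' γ r₀)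
    (hfreq : ∃ᶠ r in 𝓝 r₀, modelDeriv ℝ E' γ r 1 ∈ fiberRange E E' E' f k (σ (γ r)) ∧
      finrank ℝ (fiberRange E E' E' f k (σ (γ r))) ≤
        finrank ℝ (fiberRange E E' E' f k (σ (γ r₀)))) :
    modelDeriv ℝ E' γ r₀ 1 ∈ fiberRange E E' E' f k (σ (γ r₀)) := by
  set ψ := chartAt E' (γ r₀)
  have hψ : SmoothNear E' E' ψ (γ r₀) := smoothNear_chartAt (mem_chart_source E' _)
  have hψγ : SmoothNear ℝ E' (ψ ∘ γ) r₀ := hψ.comp hγ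
  have hF : SmoothNear E E' (ψ ∘ k - ψ ∘ f) (σ (γ r₀)) := by
    filter_upwards [SmoothNear.comp (by rwa [hfσ]) (smoothNear_of_contMDiff hf (σ (γ r₀))),
      SmoothNear.comp (by rwa [hkσ]) (smoothNear_of_contMDiff hk (σ (γ r₀)))]
      with z hfz hkz using hkz.sub hfz
  have hrange : ∀ x ∈ ψ.source, (modelDeriv E E' (ψ ∘ k - ψ ∘ f) (σ x)).range =
      (fiberRange E E' E' f k (σ x)).map (modelDeriv E' E' ψ x).toLinearMap := fun x hx ↦
    range_modelDeriv_chartAt_comp_sub hx hfσ hkσ (hf.mdifferentiable (by simp) _)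
      (hk.mdifferentiable (by simp) _) (hσ.mdifferentiable (by simp) x)
  have hrange₀ : (modelDeriv E E' (ψ ∘ k - ψ ∘ f) (σ (γ r₀))).range =
      fiberRange E E' E' f k (σ (γ r₀)) := by
    rw [hrange _ (mem_chart_source E' _), modelDeriv_chartAt_self]
    exact Submodule.map_id _
  have hw : ContinuousAt (fun r ↦ modelDeriv ℝ E' (ψ ∘ γ) r 1) r₀ := by
    simp only [modelDeriv_eq_fderiv]
    exact (hψγ.contMDiffAt.contDiffAt.continuousAt_fderiv (by simp)).clm_apply continuousAt_const
  have hw₀ : modelDeriv ℝ E' (ψ ∘ γ) r₀ 1 = modelDeriv ℝ E' γ r₀ 1 := by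
    rw [modelDeriv_comp r₀ hψ.mdifferentiableAt hγ.mdifferentiableAt, modelDeriv_chartAt_self]
    rfl
  rw [← hw₀, ← hrange₀]
  refine mem_range_modelDeriv_of_frequently (z := σ ∘ γ) hF
    (hσ.continuous.continuousAt.comp hγ.continuousAt) hw ?_
  refine (hfreq.and_eventually (hγ.eventually_nhds.and
    (hγ.continuousAt.eventually (chart_source_mem_nhds E' (γ r₀))))).mono ?_
  rintro r ⟨⟨hr, hrank⟩, hγr, hrs⟩
  rw [mrank, mrank, Function.comp_apply, Function.comp_apply, hrange₀, hrange _ hrs,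
    modelDeriv_comp r (smoothNear_chartAt hrs).mdifferentiableAt (SmoothNear.mdifferentiableAt hγr)]
  exact ⟨⟨_, hr, rfl⟩, (Submodule.finrank_map_le _ _).trans hrank⟩

end CommonSection

section FiberRange

variable {E : Type*} [NormedAddCommGroup E] [NormedSpace ℝ E]
  {N : Type*} [TopologicalSpace N] [ChartedSpace E N]
  {E' : Type*} [NormedAddCommGroup E'] [NormedSpace ℝ E']
  {N' : Type*} [TopologicalSpace N'] [ChartedSpace E' N']
  {E'' : Type*} [NormedAddCommGroup E''] [NormedSpace ℝ E'']
  {N'' : Type*} [TopologicalSpace N''] [ChartedSpace E'' N'']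
  {E₀ : Type*} [NormedAddCommGroup E₀] [NormedSpace ℝ E₀]
  {N₀ : Type*} [TopologicalSpace N₀] [ChartedSpace E₀ N₀]
  {f : N → N'} {k : N → N''} {α : N₀ → N}

theorem fiberRange_comp_le {z : N₀} (hf : MDifferentiableAt 𝓘(ℝ, E) 𝓘(ℝ, E') f (α z))
    (hk : MDifferentiableAt 𝓘(ℝ, E) 𝓘(ℝ, E'') k (α z))
    (hα : MDifferentiableAt 𝓘(ℝ, E₀) 𝓘(ℝ, E) α z) :
    fiberRange E₀ E' E'' (f ∘ α) (k ∘ α) z ≤ fiberRange E E' E'' f k (α z) := by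
  rw [fiberRange, modelDeriv_comp z hf hα, modelDeriv_comp z hk hα]
  rintro _ ⟨u, hu, rfl⟩
  exact ⟨modelDeriv E₀ E α z u, hu, rfl⟩

theorem finrank_fiberRange_add_finrank_ker_inf_ker [FiniteDimensional ℝ E] (z : N) :
    finrank ℝ (fiberRange E E' E'' f k z) +
        finrank ℝ ((modelDeriv E E' f z).ker ⊓ (modelDeriv E E'' k z).ker : Submodule ℝ E) =
      finrank ℝ (modelDeriv E E' f z).ker := by
  set T := (modelDeriv E E'' k z).toLinearMap.domRestrict (modelDeriv E E' f z).ker with hT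
  have hker : T.ker.map (modelDeriv E E' f z).ker.subtype =
      (modelDeriv E E' f z).ker ⊓ (modelDeriv E E'' k z).ker := by
    rw [hT, LinearMap.ker_domRestrict]
    exact Submodule.map_comap_subtype _ _
  have hrank := T.finrank_range_add_finrank_ker
  rwa [LinearMap.range_domRestrict, ← Submodule.finrank_map_subtype_eq, hker] at hrank

theorem finrank_fiberRange_add_mrank_comm [FiniteDimensional ℝ E] (z : N) :
    finrank ℝ (fiberRange E E' E'' f k z) + mrank E E' f z =
      finrank ℝ (fiberRange E E'' E' k f z) + mrank E E'' k z := by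
  have hfk := finrank_fiberRange_add_finrank_ker_inf_ker (E := E) (E' := E') (E'' := E'')
    (f := f) (k := k) z
  have hkf := finrank_fiberRange_add_finrank_ker_inf_ker (E := E) (E' := E'') (E'' := E')
    (f := k) (k := f) z
  have hf := (modelDeriv E E' f z).toLinearMap.finrank_range_add_finrank_ker
  have hk := (modelDeriv E E'' k z).toLinearMap.finrank_range_add_finrank_ker
  rw [inf_comm] at hkf
  unfold mrank
  omega

theorem mrank_eq_finrank_of_isSubmersion [IsManifold 𝓘(ℝ, E) ∞ N] [IsManifold 𝓘(ℝ, E') ∞ N']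
    (hf : IsSubmersion 𝓘(ℝ, E) 𝓘(ℝ, E') ∞ f) (z : N) : mrank E E' f z = finrank ℝ E' := by
  have hrange : (modelDeriv E E' f z).range = ⊤ :=
    LinearMap.range_eq_top.2 (mfderiv_surjective_of_isSubmersion hf z)
  rw [mrank, hrange, finrank_top]

end FiberRange

namespace LieGroupoid

variable {EM : Type*} [NormedAddCommGroup EM] [NormedSpace ℝ EM]
  {M : Type*} [TopologicalSpace M] [ChartedSpace EM M]
  {EG : Type*} [NormedAddCommGroup EG] [NormedSpace ℝ EG]
  {G : Type*} [TopologicalSpace G] [ChartedSpace EG G]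
  (𝒢 : LieGroupoid EM M EG G)

/-- The image under `d_g t` of the tangent space `ker d_g s` of the source fibre, which is the
tangent space at `t g` of the orbit. -/
noncomputable def orbitDirection (g : G) : Submodule ℝ EM :=
  fiberRange EG EM EM 𝒢.s 𝒢.t g

theorem mdifferentiableAt_s (g : G) : MDifferentiableAt 𝓘(ℝ, EG) 𝓘(ℝ, EM) 𝒢.s g :=
  𝒢.isSubmersion_s.contMDiff.mdifferentiable (by simp) g

theorem mdifferentiableAt_t (g : G) : MDifferentiableAt 𝓘(ℝ, EG) 𝓘(ℝ, EM) 𝒢.t g :=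
  𝒢.isSubmersion_t.contMDiff.mdifferentiable (by simp) g

theorem smoothNear_s (g : G) : SmoothNear EG EM 𝒢.s g :=
  smoothNear_of_contMDiff 𝒢.isSubmersion_s.contMDiff g

theorem smoothNear_t (g : G) : SmoothNear EG EM 𝒢.t g :=
  smoothNear_of_contMDiff 𝒢.isSubmersion_t.contMDiff g

theorem mfderiv_anchor_apply (g : G) (u : TangentSpace 𝓘(ℝ, EG) g) :
    mfderiv 𝓘(ℝ, EG) (𝓘(ℝ, EM).prod 𝓘(ℝ, EM)) 𝒢.anchor g u =
      (mfderiv 𝓘(ℝ, EG) 𝓘(ℝ, EM) 𝒢.t g u, mfderiv 𝓘(ℝ, EG) 𝓘(ℝ, EM) 𝒢.s g u) :=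
  DFunLike.congr_fun ((𝒢.mdifferentiableAt_t g).hasMFDerivAt.prodMk
    (𝒢.mdifferentiableAt_s g).hasMFDerivAt).mfderiv u

theorem arrows_eq_preimage_inter_preimage (y x : M) :
    𝒢.arrows y x = 𝒢.s ⁻¹' {x} ∩ 𝒢.t ⁻¹' {y} :=
  inter_comm _ _

variable [IsManifold 𝓘(ℝ, EM) ∞ M] [IsManifold 𝓘(ℝ, EG) ∞ G]

theorem isLocalMax_mrank_s (g : G) : IsLocalMax (mrank EG EM 𝒢.s) g :=
  .of_forall fun h ↦ ((mrank_eq_finrank_of_isSubmersion 𝒢.isSubmersion_s h).trans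
    (mrank_eq_finrank_of_isSubmersion 𝒢.isSubmersion_s g).symm).le

variable [FiniteDimensional ℝ EG]

theorem orbitDirection_le_mul {h k : G} (hk : 𝒢.s h = 𝒢.t k) :
    𝒢.orbitDirection h ≤ 𝒢.orbitDirection (𝒢.mul h k) := by
  obtain ⟨lam, hlam⟩ := (𝒢.smoothNear_s h).exists_isFiberRetractionAt (𝒢.isLocalMax_mrank_s h)
  set m : G → G := fun z ↦ 𝒢.mul (lam z) k
  have hcomp : ∀ᶠ z in 𝓝 h, 𝒢.s (lam z) = 𝒢.t k := hlam.eventually_apply.mono fun z hz ↦ hz.trans hk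
  have hm : MDifferentiableAt 𝓘(ℝ, EG) 𝓘(ℝ, EG) m h :=
    (((𝒢.contMDiffOn_mul (lam h, k) hcomp.self_of_nhds).comp h
      (s := {z | 𝒢.s (lam z) = 𝒢.t k})
      (hlam.smoothNear.contMDiffAt.contMDiffWithinAt.prodMk contMDiffWithinAt_const)
      fun _ hz ↦ hz).contMDiffAt hcomp).mdifferentiableAt (by simp)
  have hmh : m h = 𝒢.mul h k := by simp only [m, hlam.apply_self]
  have hle := fiberRange_comp_le (𝒢.mdifferentiableAt_s (m h)) (𝒢.mdifferentiableAt_t (m h)) hm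
  rw [hmh] at hle
  refine le_trans ?_ hle
  rintro _ ⟨u, hu, rfl⟩
  have hs : modelDeriv EG EM (𝒢.s ∘ m) h = 0 :=
    modelDeriv_eq_zero_of_eventually_eq (hcomp.mono fun z hz ↦ 𝒢.s_mul _ _ hz)
  have ht : modelDeriv EG EM (𝒢.t ∘ m) h = modelDeriv EG EM (𝒢.t ∘ lam) h :=
    modelDeriv_congr (hcomp.mono fun z hz ↦ 𝒢.t_mul _ _ hz)
  exact ⟨u, DFunLike.congr_fun hs u,
    (DFunLike.congr_fun ht u).trans (hlam.modelDeriv_comp_apply (𝒢.smoothNear_t h) hu)⟩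

theorem orbitDirection_eq_one (g : G) :
    𝒢.orbitDirection g = 𝒢.orbitDirection (𝒢.one (𝒢.t g)) := by
  apply le_antisymm
  · simpa only [𝒢.mul_inv] using 𝒢.orbitDirection_le_mul (𝒢.t_inv g).symm
  · simpa only [𝒢.one_mul] using 𝒢.orbitDirection_le_mul (𝒢.s_one (𝒢.t g))

theorem finrank_orbitDirection_le_inv (g : G) :
    finrank ℝ (𝒢.orbitDirection g) ≤ finrank ℝ (𝒢.orbitDirection (𝒢.inv g)) := by
  have hcomm := finrank_fiberRange_add_mrank_comm (E := EG) (E' := EM) (E'' := EM)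
    (f := 𝒢.s) (k := 𝒢.t) g
  rw [mrank_eq_finrank_of_isSubmersion 𝒢.isSubmersion_s,
    mrank_eq_finrank_of_isSubmersion 𝒢.isSubmersion_t, Nat.add_right_cancel_iff] at hcomm
  have hle := fiberRange_comp_le (𝒢.mdifferentiableAt_s (𝒢.inv g)) (𝒢.mdifferentiableAt_t _)
    (𝒢.contMDiff_inv.mdifferentiable (by simp) g)
  rw [show 𝒢.s ∘ 𝒢.inv = 𝒢.t from funext 𝒢.s_inv,
    show 𝒢.t ∘ 𝒢.inv = 𝒢.s from funext 𝒢.t_inv] at hle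
  have hrank := Submodule.finrank_mono hle
  exact hcomm.trans_le hrank

theorem finrank_orbitDirection_eq_one_s (g : G) :
    finrank ℝ (𝒢.orbitDirection g) = finrank ℝ (𝒢.orbitDirection (𝒢.one (𝒢.s g))) := by
  rw [← 𝒢.t_inv g, ← 𝒢.orbitDirection_eq_one]
  refine (𝒢.finrank_orbitDirection_le_inv g).antisymm ?_
  have hle := 𝒢.finrank_orbitDirection_le_inv (𝒢.inv g)
  rwa [𝒢.orbitDirection_eq_one (𝒢.inv (𝒢.inv g)), 𝒢.t_inv, 𝒢.s_inv,
    ← 𝒢.orbitDirection_eq_one] at hle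

theorem finrank_orbitDirection_one_of_mem_orbit {x y : M} (hy : y ∈ 𝒢.orbit x) :
    finrank ℝ (𝒢.orbitDirection (𝒢.one y)) = finrank ℝ (𝒢.orbitDirection (𝒢.one x)) := by
  obtain ⟨g, rfl, rfl⟩ := hy
  rw [← 𝒢.orbitDirection_eq_one, 𝒢.finrank_orbitDirection_eq_one_s]

theorem finrank_orbitDirection_eq_of_s_eq {g h : G} (hgh : 𝒢.s g = 𝒢.s h) :
    finrank ℝ (𝒢.orbitDirection g) = finrank ℝ (𝒢.orbitDirection h) := by
  rw [𝒢.finrank_orbitDirection_eq_one_s g, hgh, ← 𝒢.finrank_orbitDirection_eq_one_s h]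

theorem isLocalMaxOn_finrank_orbitDirection (g : G) :
    IsLocalMaxOn (fun h ↦ finrank ℝ (𝒢.orbitDirection h)) (𝒢.s ⁻¹' {𝒢.s g}) g :=
  eventually_nhdsWithin_of_forall fun _ hh ↦ (𝒢.finrank_orbitDirection_eq_of_s_eq hh).le

theorem ker_mfderiv_anchor (g : G) :
    (mfderiv 𝓘(ℝ, EG) (𝓘(ℝ, EM).prod 𝓘(ℝ, EM)) 𝒢.anchor g).ker =
      submanifoldTangentSpace (𝒢.arrows (𝒢.t g) (𝒢.s g)) g := by
  apply le_antisymm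
  · intro u hu
    have htu := (𝒢.mfderiv_anchor_apply g u).symm.trans hu
    rw [arrows_eq_preimage_inter_preimage]
    exact ker_inf_ker_le_submanifoldTangentSpace (𝒢.smoothNear_s g) (𝒢.smoothNear_t g)
      (𝒢.isLocalMax_mrank_s g) (𝒢.isLocalMaxOn_finrank_orbitDirection g)
      ⟨congrArg Prod.snd htu, congrArg Prod.fst htu⟩
  · intro u hu
    exact (𝒢.mfderiv_anchor_apply g u).trans (Prod.ext
      (submanifoldTangentSpace_le_ker (𝒢.mdifferentiableAt_t g) (fun _ hz ↦ hz.1) hu)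
      (submanifoldTangentSpace_le_ker (𝒢.mdifferentiableAt_s g) (fun _ hz ↦ hz.2) hu))

variable [SecondCountableTopology G]

theorem countable_setOf_velocity_notMem_orbitDirection {γ : ℝ → M} {x : M} {I : Set ℝ}
    (hγ : ∀ r ∈ I, MDifferentiableAt 𝓘(ℝ, ℝ) 𝓘(ℝ, EM) γ r) (hγx : ∀ r ∈ I, γ r ∈ 𝒢.orbit x) :
    {r ∈ I | modelDeriv ℝ EM γ r 1 ∉ 𝒢.orbitDirection (𝒢.one (γ r))}.Countable := by
  have : Nonempty G := ⟨𝒢.one x⟩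
  choose! h hs ht using hγx
  refine (countable_setOf_not_accPt_graphOn h I).mono ?_
  rintro r ⟨hr, hnot⟩
  refine ⟨hr, fun hacc ↦ hnot ?_⟩
  rw [← ht r hr, ← 𝒢.orbitDirection_eq_one]
  exact velocity_mem_fiberRange_of_accPt hr (fun r' hr' ↦ (hs r' hr').trans (hs r hr).symm) ht hacc
    (hγ r hr) (𝒢.smoothNear_s _) (𝒢.smoothNear_t _) (𝒢.isLocalMax_mrank_s _)
    (𝒢.isLocalMaxOn_finrank_orbitDirection _)

theorem orbitTangentSpace_le (x : M) :
    𝒢.orbitTangentSpace x ≤ 𝒢.orbitDirection (𝒢.one x) := by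
  refine submanifoldTangentSpace_le fun γ hγ hγx hγorbit ↦ ?_
  obtain rfl := hγx
  have hcountable := 𝒢.countable_setOf_velocity_notMem_orbitDirection
    (I := {r | MDifferentiableAt 𝓘(ℝ, ℝ) 𝓘(ℝ, EM) γ r ∧ γ r ∈ 𝒢.orbit (γ 0)})
    (fun r hr ↦ hr.1) fun r hr ↦ hr.2
  have hfreq := (mem_closure_iff_frequently.1 (hcountable.dense_compl ℝ 0)).and_eventually
    (hγ.eventually_nhds.and hγorbit)
  refine velocity_mem_fiberRange_of_frequently 𝒢.isSubmersion_s.contMDiff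
    𝒢.isSubmersion_t.contMDiff 𝒢.contMDiff_one 𝒢.s_one 𝒢.t_one hγ (hfreq.mono ?_)
  rintro r ⟨hr, hγr, hr'⟩
  refine ⟨?_, (𝒢.finrank_orbitDirection_one_of_mem_orbit hr').le⟩
  by_contra hnot
  exact hr ⟨⟨SmoothNear.mdifferentiableAt hγr, hr'⟩, hnot⟩

theorem orbitTangentSpace_eq_orbitDirection (g : G) :
    𝒢.orbitTangentSpace (𝒢.t g) = 𝒢.orbitDirection g := by
  apply le_antisymm
  · rw [𝒢.orbitDirection_eq_one]
    exact 𝒢.orbitTangentSpace_le (𝒢.t g)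
  · rintro _ ⟨u, hu, rfl⟩
    exact mfderiv_mem_submanifoldTangentSpace 𝒢.isSubmersion_t.contMDiff
      (fun h (hh : 𝒢.s h = 𝒢.s g) ↦ 𝒢.t_mem_orbit g h (hh ▸ 𝒢.mem_orbit_self (𝒢.s g))) g
      (ker_le_submanifoldTangentSpace_preimage 𝒢.isSubmersion_s (mem_singleton (𝒢.s g)) hu)

theorem mem_range_mfderiv_anchor_iff (g : G) (v : TangentSpace 𝓘(ℝ, EM) (𝒢.t g))
    (w : TangentSpace 𝓘(ℝ, EM) (𝒢.s g)) :
    ((v, w) : TangentSpace (𝓘(ℝ, EM).prod 𝓘(ℝ, EM)) (𝒢.anchor g)) ∈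
        (mfderiv 𝓘(ℝ, EG) (𝓘(ℝ, EM).prod 𝓘(ℝ, EM)) 𝒢.anchor g).range ↔
      (Submodule.Quotient.mk v : 𝒢.NormalSpace (𝒢.t g)) =
        𝒢.normalRep g (Submodule.Quotient.mk w) := by
  constructor
  · rintro ⟨u, hu⟩
    have hvw := (𝒢.mfderiv_anchor_apply g u).symm.trans hu
    obtain rfl : mfderiv 𝓘(ℝ, EG) 𝓘(ℝ, EM) 𝒢.t g u = v := congrArg Prod.fst hvw
    obtain rfl : mfderiv 𝓘(ℝ, EG) 𝓘(ℝ, EM) 𝒢.s g u = w := congrArg Prod.snd hvw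
    exact (𝒢.normalRep_mk g u).symm
  · intro hvw
    obtain ⟨u, rfl⟩ := mfderiv_surjective_of_isSubmersion 𝒢.isSubmersion_s g w
    rw [𝒢.normalRep_mk, Submodule.Quotient.eq] at hvw
    obtain ⟨(u' : TangentSpace 𝓘(ℝ, EG) g), hsu', htu'⟩ :=
      (𝒢.orbitTangentSpace_eq_orbitDirection g).le hvw
    refine ⟨u + u', (𝒢.mfderiv_anchor_apply g (u + u')).trans (Prod.ext ?_ ?_)⟩
    · exact (map_add (mfderiv 𝓘(ℝ, EG) 𝓘(ℝ, EM) 𝒢.t g) u u').trans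
        ((congrArg _ htu').trans (add_sub_cancel _ v))
    · exact (map_add (mfderiv 𝓘(ℝ, EG) 𝓘(ℝ, EM) 𝒢.s g) u u').trans
        ((congrArg _ hsu').trans (add_zero _))

end LieGroupoid

theorem mainTheorem7_general
    {EM : Type*} [NormedAddCommGroup EM] [NormedSpace ℝ EM]
    {M : Type*} [TopologicalSpace M] [ChartedSpace EM M] [IsManifold 𝓘(ℝ, EM) ∞ M]
    {EG : Type*} [NormedAddCommGroup EG] [NormedSpace ℝ EG] [FiniteDimensional ℝ EG]
    {G : Type*} [TopologicalSpace G] [SecondCountableTopology G]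
    [ChartedSpace EG G] [IsManifold 𝓘(ℝ, EG) ∞ G]
    (𝒢 : LieGroupoid EM M EG G) (g : G) :
    (mfderiv 𝓘(ℝ, EG) (𝓘(ℝ, EM).prod 𝓘(ℝ, EM)) 𝒢.anchor g).ker =
        submanifoldTangentSpace (𝒢.arrows (𝒢.t g) (𝒢.s g)) g ∧
      ∀ (v : TangentSpace 𝓘(ℝ, EM) (𝒢.t g)) (w : TangentSpace 𝓘(ℝ, EM) (𝒢.s g)),
        ((v, w) : TangentSpace (𝓘(ℝ, EM).prod 𝓘(ℝ, EM)) (𝒢.anchor g)) ∈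
            (mfderiv 𝓘(ℝ, EG) (𝓘(ℝ, EM).prod 𝓘(ℝ, EM)) 𝒢.anchor g).range ↔
          (Submodule.Quotient.mk v : 𝒢.NormalSpace (𝒢.t g)) =
            𝒢.normalRep g (Submodule.Quotient.mk w) :=
  ⟨𝒢.ker_mfderiv_anchor g, 𝒢.mem_range_mfderiv_anchor_iff g⟩

theorem mainTheorem7
    {EM : Type*} [NormedAddCommGroup EM] [NormedSpace ℝ EM] [FiniteDimensional ℝ EM]
    {M : Type*} [TopologicalSpace M] [T2Space M] [SecondCountableTopology M]
    [ChartedSpace EM M] [IsManifold 𝓘(ℝ, EM) ∞ M]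
    {EG : Type*} [NormedAddCommGroup EG] [NormedSpace ℝ EG] [FiniteDimensional ℝ EG]
    {G : Type*} [TopologicalSpace G] [T2Space G] [SecondCountableTopology G]
    [ChartedSpace EG G] [IsManifold 𝓘(ℝ, EG) ∞ G]
    (𝒢 : LieGroupoid EM M EG G) (g : G) :
    (mfderiv 𝓘(ℝ, EG) (𝓘(ℝ, EM).prod 𝓘(ℝ, EM)) 𝒢.anchor g).ker =
        submanifoldTangentSpace (𝒢.arrows (𝒢.t g) (𝒢.s g)) g ∧
      ∀ (v : TangentSpace 𝓘(ℝ, EM) (𝒢.t g)) (w : TangentSpace 𝓘(ℝ, EM) (𝒢.s g)),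
        ((v, w) : TangentSpace (𝓘(ℝ, EM).prod 𝓘(ℝ, EM)) (𝒢.anchor g)) ∈
            (mfderiv 𝓘(ℝ, EG) (𝓘(ℝ, EM).prod 𝓘(ℝ, EM)) 𝒢.anchor g).range ↔
          (Submodule.Quotient.mk v : 𝒢.NormalSpace (𝒢.t g)) =
            𝒢.normalRep g (Submodule.Quotient.mk w) :=
  mainTheorem7_general 𝒢 g
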